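/- Let $p$ be a prime, $L$ a finite extension of $\mathbb{Q}_p$ with valuation ring $\mathcal{O}_L$, uniformizer $\pi_L$ and ramification index $e$ over $\mathbb{Q}_p$, let $|\cdot|$ be the absolute value with $|p|=p^{-1}$, and let $G$ be a compact topological group. Let $\mathcal{A}$ be a Noetherian adic $\mathcal{O}_L$-algebra having an ideal of definition $I\ni\pi_L$ such that $\mathcal{A}/I$ is a finitely generated $\mathcal{O}_L/\pi_L$-algebra. We say that $\mathcal{X}=\operatorname{Spf}\mathcal{A}$ is an affine formal model of a rigid analytic space $X$ over $L$ if it comes with an isomorphism $\mathcal{X}^{\mathrm{rig}}\cong X$, where $\mathcal{X}^{\mathrm{rig}}$ is the generic fibre in the sense of Berthelot. A $G$-representation on $X$ (respectively, on $\mathcal{X}$) is a free module of finite rank over $\mathcal{O}_X(X)$ (respectively, over $\mathcal{A}$) with a continuous linear action of $G$. A free lattice, over $\mathcal{X}$, for a $G$-representation $\mathbf{V}$ on $X$ is a $G$-representation $\mathcal{V}$ on $\mathcal{X}$ such that $\mathcal{V}\otimes_{\mathcal{A}}\mathcal{O}_X(X)\cong\mathbf{V}$, $G$-equivariantly. For $x\in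 X(L)$, let $I_x=\{f\in\mathcal{A} : f(x)=0\}$ and, for $n\ge 1$, let $$U^{(n)}_{x,\mathcal{X}}=\{y\in X : |f(y)|<p^{(1-n)/e}\ \ \forall f\in I_x\},\qquad V^{(n)}_{x,\mathcal{X}}=\{y\in X : |f(y)|\le p^{-n/e}\ \ \forall f\in I_x\}.$$ For a finite extension $E/L$ with uniformizer $\pi_E$ and ramification index $e_{E/L}$, put $\gamma_{E/L}(n)=(n-1)e_{E/L}+1$. A $G$-representation $\mathcal{V}$ on $\mathcal{X}=\operatorname{Spf}\mathcal{A}$ is called * pointwise constant mod $p^n$ if, for every finite extension $E/L$, the isomorphism class of the $\mathcal{O}_E/\pi_E^{\gamma_{E/L}(n)}[G]$-module $\mathcal{V}\otimes_{\mathcal{A},y}\mathcal{O}_E/\pi_E^{\gamma_{E/L}(n)}$ is independent of the continuous $\mathcal{O}_L$-algebra homomorphism $y\colon\mathcal{A}\to\mathcal{O}_E$; * constant mod $\pi_L^n$ if there is a finite free $\mathcal{O}_L/\pi_L^n$-module $W$ with a linear action of $G$ and a $G$-equivariant isomorphism $\mathcal{V}/\pi_L^n\mathcal{V}\cong W\otimes_{\mathcal{O}_L/\pi_L^n}\mathcal{A}/\pi_L^n\mathcal{A}$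 of $\mathcal{A}/\pi_L^n\mathcal{A}$-modules. A $G$-representation on a rigid analytic space $Y$ has one of these properties if it admits a free lattice, over some affine formal model of $Y$, which has it. **Theorem.** Let $X$ be a rigid analytic space over $L$ and let $\mathbf{V}$ be a $G$-representation on $X$ that admits a free lattice over an affine formal model $\mathcal{X}$ of $X$. Then, for every $x\in X(L)$ and every integer $n\ge 1$, the restriction of $\mathbf{V}$ to $U^{(n)}_{x,\mathcal{X}}$ is pointwise constant mod $p^n$, and the restriction of $\mathbf{V}$ to $V^{(n)}_{x,\mathcal{X}}$ is constant mod $\pi_L^n$. -/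

import Mathlib

open CategoryTheory IsLocalRing
open scoped TensorProduct

universe u v w w'

noncomputable section

namespace RigidLattice

/-! ### Valuation rings and ramification indices -/

/-- The valuation ring of a non-archimedean normed field: the elements of norm at most `1`. -/
abbrev IntRing (K : Type u) [NormedField K] [IsUltrametricDist K] : ValuationSubring K :=
  (NormedField.valuation (K := K)).valuationSubring

theorem mem_intRing {K : Type u} [NormedField K] [IsUltrametricDist K] {x : K} :
    x ∈ IntRing K ↔ ‖x‖ ≤ 1 := by
  rw [Valuation.mem_valuationSubring_iff, NormedField.valuation_apply, ← NNReal.coe_le_coe,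
    coe_nnnorm, NNReal.coe_one]

/-- The inclusion of valuation rings attached to an extension `K'/K` of normed fields. -/
def intRingMap (K : Type u) (K' : Type v) [NormedField K] [IsUltrametricDist K]
    [NormedField K'] [IsUltrametricDist K'] [NormedAlgebra K K'] : IntRing K →+* IntRing K' :=
  ((algebraMap K K').comp (IntRing K).subtype).codRestrict (IntRing K') fun x => by
    have hx : ‖(x : K)‖ ≤ 1 := mem_intRing.1 x.2
    rw [mem_intRing]
    simpa [norm_algebraMap'] using hx

/-- The ramification index `e_{K'/K}`: the largest `m` such that the maximal ideal of the
valuation ring of `K` is contained in the `m`-th power of the maximal ideal of that of `K'`. -/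
def ramIdx (K : Type u) (K' : Type v) [NormedField K] [IsUltrametricDist K]
    [NormedField K'] [IsUltrametricDist K'] [NormedAlgebra K K'] : ℕ :=
  letI := (intRingMap K K').toAlgebra
  (maximalIdeal (IntRing K)).ramificationIdx' (maximalIdeal (IntRing K'))

/-- `γ_{K'/K}(n) = (n - 1) e_{K'/K} + 1`, for `n ≥ 1`. -/
def gam (K : Type u) (K' : Type v) [NormedField K] [IsUltrametricDist K]
    [NormedField K'] [IsUltrametricDist K'] [NormedAlgebra K K'] (n : ℕ) : ℕ :=
  (n - 1) * ramIdx K K' + 1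

/-! ### Representations and extension of scalars -/

section Reps

variable {R : Type u} {S : Type v} [CommRing R] [CommRing S] {G : Type w} [Group G]

/-- Extension of scalars `S ⊗[R] M`, with the `S`-linear extension of the action of `G`, along a
ring homomorphism `f : R → S`. -/
def extScalars (f : R →+* S) (M : Rep.{w'} R G) : Rep.{max v w'} S G :=
  letI := f.toAlgebra
  Rep.of (X := S ⊗[R] M.V)
    { toFun := fun g => (M.ρ g).baseChange S
      map_one' := by rw [map_one]; exact LinearMap.baseChange_id
      map_mul' := fun g h => by rw [map_mul]; exact LinearMap.baseChange_mul (M.ρ g) (M.ρ h) }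

/-- Two `R`-linear representations of `G` are isomorphic. -/
def RepIso (M : Rep.{v} R G) (N : Rep.{w'} R G) : Prop := Nonempty (M.ρ.Equiv N.ρ)

/-- `M` is a continuous representation of `G` on a free module of finite rank over the topological
ring `R`. Continuity means that all matrix coefficients are continuous functions `G → R`; it is
equivalent to ask this for the matrix entries in one basis, i.e. that `G → GL_d(R)` is
continuous. -/
structure IsFreeContRep [TopologicalSpace R] [TopologicalSpace G] (M : Rep.{w'} R G) : Prop where
  free : Module.Free R M
  finite : Module.Finite R M
  continuous : ∀ (l : Module.Dual R M) (m : M), Continuous fun g => l (M.ρ g m)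

end Reps

/-! ### Affinoid algebras and rigid spaces -/

section Spaces

variable (L : Type u) [NormedField L] [IsUltrametricDist L]

/-- The Tate algebra `L⟨X₁, …, X_n⟩`: power series whose coefficients tend to zero. -/
abbrev TateAlg (n : ℕ) : Subring (MvPowerSeries (Fin n) L) :=
  MvPowerSeries.IsRestricted.subring (R := L) (σ := Fin n) fun _ => 1

/-- The constants in the Tate algebra. -/
def TateAlg.const (n : ℕ) (a : L) : TateAlg L n :=
  ⟨MvPowerSeries.C a, MvPowerSeries.isRestricted_C _ a⟩

/-- Affinoid `L`-algebras: `L`-Banach algebras that admit a surjective `L`-algebra homomorphism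
from some Tate algebra, continuous (that is, bounded) for the Gauss norm of the latter. -/
structure AffinoidAlg where
  carrier : Type u
  [normedCommRing : NormedCommRing carrier]
  [normedAlgebra : NormedAlgebra L carrier]
  [ultrametric : IsUltrametricDist carrier]
  [complete : CompleteSpace carrier]
  exists_presentation : ∃ (n : ℕ) (π : TateAlg L n →+* carrier),
    Function.Surjective π ∧ (∀ a : L, π (TateAlg.const L n a) = algebraMap L carrier a) ∧
    ∃ K : ℝ, ∀ (f : TateAlg L n) (c : ℝ),
      (∀ t, ‖MvPowerSeries.coeff t (f : MvPowerSeries (Fin n) L)‖ ≤ c) → ‖π f‖ ≤ K * c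

attribute [instance] AffinoidAlg.normedCommRing AffinoidAlg.normedAlgebra
  AffinoidAlg.ultrametric AffinoidAlg.complete

instance : CoeSort (AffinoidAlg L) (Type u) := ⟨AffinoidAlg.carrier⟩

/-- The category of affinoid `L`-algebras, with the continuous `L`-algebra homomorphisms (every
`L`-algebra homomorphism of affinoid algebras is continuous). -/
instance : Category (AffinoidAlg L) where
  Hom C D := C →A[L] D
  id C := ContinuousAlgHom.id L C
  comp f g := g.comp f

/-- The homomorphism of algebras underlying a morphism in the category of affinoid algebras. -/
abbrev AffinoidAlg.hom {C D : AffinoidAlg L} (ψ : C ⟶ D) : C →A[L] D := ψ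

/-- The field `L` as an affinoid algebra (no variables). -/
def AffinoidAlg.self [CompleteSpace L] : AffinoidAlg L where
  carrier := L
  exists_presentation := by
    refine ⟨0, (MvPowerSeries.constantCoeff (σ := Fin 0) (R := L)).comp (TateAlg L 0).subtype,
      fun a => ⟨TateAlg.const L 0 a, ?_⟩, fun a => ?_, 1, fun f c h => ?_⟩
    · simp [TateAlg.const]
    · simp [TateAlg.const]
    · simpa using h 0

/-- Rigid analytic spaces over `L` are treated through their functors of points on affinoid
spaces: `X.obj C` is the set of morphisms `Sp C → X`. A rigid space is determined by this functor,
and morphisms of rigid spaces are the natural transformations. -/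
abbrev RigidFunctor := AffinoidAlg L ⥤ Type u

variable {L}

/-- The ring `𝒪_X(X)` of global functions on `X`, i.e. of morphisms from `X` to the affine line:
the compatible families of functions on all affinoids mapping to `X`. Its topology is the coarsest
one for which all the restriction maps to these affinoids are continuous. -/
def GlobalFun (X : RigidFunctor L) : Subring (∀ C : AffinoidAlg L, X.obj C → C) where
  carrier := {f | ∀ (C D : AffinoidAlg L) (ψ : C ⟶ D) (y : X.obj C),
    f D (X.map ψ y) = AffinoidAlg.hom L ψ (f C y)}
  mul_mem' {f g} hf hg C D ψ y := by
    rw [Pi.mul_apply, Pi.mul_apply, Pi.mul_apply, Pi.mul_apply, hf C D ψ y, hg C D ψ y, map_mul]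
  one_mem' C D ψ y := by
    simp only [Pi.one_apply, map_one]
  add_mem' {f g} hf hg C D ψ y := by
    rw [Pi.add_apply, Pi.add_apply, Pi.add_apply, Pi.add_apply, hf C D ψ y, hg C D ψ y, map_add]
  zero_mem' C D ψ y := by
    simp only [Pi.zero_apply, map_zero]
  neg_mem' {f} hf C D ψ y := by
    rw [Pi.neg_apply, Pi.neg_apply, Pi.neg_apply, Pi.neg_apply, hf C D ψ y, map_neg]

/-- Pull-back of functions along a morphism. -/
def GlobalFun.pullback {X Y : RigidFunctor L} (i : Y ⟶ X) : GlobalFun X →+* GlobalFun Y where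
  toFun f := ⟨fun C y => f.1 C (i.app C y), fun C D ψ y => by
    have h := NatTrans.naturality_apply i ψ y
    exact (congrArg (f.1 D) h).trans (f.2 C D ψ (i.app C y))⟩
  map_one' := rfl
  map_mul' _ _ := rfl
  map_zero' := rfl
  map_add' _ _ := rfl

/-! ### Affine formal schemes and Berthelot's generic fibre -/

variable (L) in
/-- Noetherian adic `𝒪_L`-algebras `A` with an ideal of definition `I` (containing the maximal
ideal `𝔪_L` of `𝒪_L`) such that `A/I` is a finitely generated algebra over `𝒪_L/𝔪_L`. -/
structure FormalAlg where
  carrier : Type u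
  [commRing : CommRing carrier]
  [algebra : Algebra (IntRing L) carrier]
  [topology : TopologicalSpace carrier]
  noetherian : IsNoetherianRing carrier
  exists_idealOfDefinition : ∃ I : Ideal carrier, IsAdic I ∧ IsAdicComplete I carrier ∧
    (maximalIdeal (IntRing L)).map (algebraMap (IntRing L) carrier) ≤ I ∧
    Algebra.FiniteType (IntRing L) (carrier ⧸ I)

attribute [instance] FormalAlg.commRing FormalAlg.algebra FormalAlg.topology

instance : CoeSort (FormalAlg L) (Type u) := ⟨FormalAlg.carrier⟩

/-- Continuous homomorphisms of `𝒪_L`-algebras from `A` to a topological `L`-algebra `C`. -/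
def ContHom (A : FormalAlg L) (C : Type u) [CommRing C] [TopologicalSpace C] [Algebra L C] :
    Type u :=
  {φ : A →+* C // Continuous φ ∧
    ∀ r : IntRing L, φ (algebraMap (IntRing L) A r) = algebraMap L C (r : L)}

/-- Berthelot's generic fibre of `Spf A`: its points with values in an affinoid algebra `C` are
the continuous `𝒪_L`-algebra homomorphisms `A → C`. -/
def genericFiber (A : FormalAlg L) : RigidFunctor L where
  obj C := ContHom A C
  map {C D} ψ := ↾fun φ => ⟨((AffinoidAlg.hom L ψ : C →ₐ[L] D) : C →+* D).comp φ.1,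
    (AffinoidAlg.hom L ψ).cont.comp φ.2.1, fun r => by
      rw [RingHom.comp_apply, φ.2.2 r]
      exact (AffinoidAlg.hom L ψ).commutes' (r : L)⟩
  map_id _ := rfl
  map_comp _ _ := rfl

/-- An affine formal model of `X`: an affine formal scheme `Spf A` together with an isomorphism
from its generic fibre to `X`. -/
structure AffineFormalModel (X : RigidFunctor L) where
  A : FormalAlg L
  iso : genericFiber A ≅ X

/-- The homomorphism `A → C` that corresponds to a morphism `Sp C → X`, for `Spf A` an affine
formal model of `X`. -/
def AffineFormalModel.point {X : RigidFunctor L} (𝒳 : AffineFormalModel X) {C : AffinoidAlg L}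
    (y : X.obj C) : ContHom 𝒳.A C :=
  𝒳.iso.inv.app C y

/-- The canonical map from `A` to `𝒪_X(X)`, for `Spf A` an affine formal model of `X`. -/
def AffineFormalModel.toGlobal {X : RigidFunctor L} (𝒳 : AffineFormalModel X) :
    𝒳.A →+* GlobalFun X where
  toFun a := ⟨fun C y => (𝒳.point y).1 a, fun C D ψ y => by
    have h := NatTrans.naturality_apply 𝒳.iso.inv ψ y
    exact congrArg (fun φ : ContHom 𝒳.A D => φ.1 a) h⟩
  map_one' := by ext C y; exact map_one (𝒳.point y).1
  map_mul' a b := by ext C y; exact map_mul (𝒳.point y).1 a b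
  map_zero' := by ext C y; exact map_zero (𝒳.point y).1
  map_add' a b := by ext C y; exact map_add (𝒳.point y).1 a b

/-! ### Residue neighbourhoods -/

/-- The ideal `I_x` of the elements of `A` that vanish at `x ∈ X(L)`. -/
def vanishingIdeal [CompleteSpace L] {X : RigidFunctor L} (𝒳 : AffineFormalModel X)
    (x : X.obj (AffinoidAlg.self L)) : Ideal 𝒳.A where
  carrier := {f | (𝒳.toGlobal f).1 (AffinoidAlg.self L) x = 0}
  add_mem' {a b} ha hb := by
    have := congrFun (congrFun (congrArg Subtype.val (map_add 𝒳.toGlobal a b))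
      (AffinoidAlg.self L)) x
    exact this.trans ((congrArg₂ (· + ·) ha hb).trans (add_zero _))
  zero_mem' := congrFun (congrFun (congrArg Subtype.val (map_zero 𝒳.toGlobal))
      (AffinoidAlg.self L)) x
  smul_mem' c a ha := by
    have := congrFun (congrFun (congrArg Subtype.val (map_mul 𝒳.toGlobal c a))
      (AffinoidAlg.self L)) x
    exact this.trans ((congrArg _ ha).trans (mul_zero _))

/-- The subspace of `X` cut out by a condition on the absolute values of functions in a set
`S ⊆ A`, where `Spf A` is an affine formal model of `X`. A morphism `Sp C → X` factors through it
if and only if the condition `P |f(y)|` holds for all `f ∈ S` at the image of every point of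
`Sp C`; the points of `Sp C` are given by homomorphisms from `C` to finite extensions of `L`. -/
def normLocus {X : RigidFunctor L} (𝒳 : AffineFormalModel X) (S : Set 𝒳.A) (P : ℝ → Prop) :
    Subfunctor X where
  obj C := {y | ∀ (E : Type u) [NormedField E] [IsUltrametricDist E] [NormedAlgebra L E]
    [FiniteDimensional L E] (ψ : C →A[L] E), ∀ f ∈ S, P ‖ψ ((𝒳.toGlobal f).1 C y)‖}
  map {C D} i y hy E _ _ _ _ ψ f hf := by
    rw [(𝒳.toGlobal f).2 C D i y]
    exact hy E (ψ.comp (AffinoidAlg.hom L i)) f hf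

/-- The wide open residue neighbourhood `U_x^{(n)}`, defined by `|f(y)| < p^{(1-n)/e}` for all
`f ∈ I_x`, where `e` is the ramification index of `L` over `ℚ_p`. -/
def wideOpenNhd (p : ℕ) [Fact p.Prime] [CompleteSpace L] [NormedAlgebra ℚ_[p] L]
    {X : RigidFunctor L} (𝒳 : AffineFormalModel X) (x : X.obj (AffinoidAlg.self L)) (n : ℕ) :
    Subfunctor X :=
  normLocus 𝒳 (vanishingIdeal 𝒳 x) fun r => r < (p : ℝ) ^ ((1 - (n : ℝ)) / (ramIdx ℚ_[p] L : ℝ))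

/-- The affinoid residue neighbourhood `V_x^{(n)}`, defined by `|f(y)| ≤ p^{-n/e}` for all
`f ∈ I_x`, where `e` is the ramification index of `L` over `ℚ_p`. -/
def affinoidNhd (p : ℕ) [Fact p.Prime] [CompleteSpace L] [NormedAlgebra ℚ_[p] L]
    {X : RigidFunctor L} (𝒳 : AffineFormalModel X) (x : X.obj (AffinoidAlg.self L)) (n : ℕ) :
    Subfunctor X :=
  normLocus 𝒳 (vanishingIdeal 𝒳 x) fun r => r ≤ (p : ℝ) ^ (-(n : ℝ) / (ramIdx ℚ_[p] L : ℝ))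

/-! ### `G`-representations on rigid spaces and their lattices -/

variable {G : Type v} [Group G] [TopologicalSpace G]

/-- A `G`-representation on a rigid space `X`: a free `𝒪_X(X)`-module of finite rank with a
continuous `𝒪_X(X)`-linear action of `G`. -/
abbrev IsGRep {X : RigidFunctor L} (V : Rep.{w} (GlobalFun X) G) : Prop := IsFreeContRep V

/-- A `G`-representation `𝒱` on `Spf A` (a free `A`-module of finite rank with a continuous
`A`-linear action of `G`) is a free lattice for `V`, over the affine formal model `𝒳 = Spf A` of
`X`, if its generic fibre `𝒱 ⊗_A 𝒪_X(X)` is isomorphic to `V`, `G`-equivariantly. -/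
structure IsLattice {X : RigidFunctor L} (𝒳 : AffineFormalModel X) (𝒱 : Rep.{u} 𝒳.A G)
    (V : Rep.{w} (GlobalFun X) G) : Prop where
  isGRep : IsFreeContRep 𝒱
  genericFiber_iso : RepIso (extScalars 𝒳.toGlobal 𝒱) V

/-- The restriction of a `G`-representation on `X` to a subspace `U` of `X`. -/
def restrict {X : RigidFunctor L} (V : Rep.{w} (GlobalFun X) G) (U : Subfunctor X) :
    Rep.{max (u + 1) w} (GlobalFun U.toFunctor) G :=
  extScalars (GlobalFun.pullback U.ι) V

/-! ### Constancy modulo powers of `p` -/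

/-- `E`-rig-points of `Spf A`, for a finite extension `E` of `L`: morphisms `Spf 𝒪_E → Spf A`
over `𝒪_L`, i.e. continuous `𝒪_L`-algebra homomorphisms `A → 𝒪_E`. -/
structure RigPoint (A : FormalAlg L) (E : Type u) [NormedField E] [IsUltrametricDist E]
    [NormedAlgebra L E] where
  hom : A →+* IntRing E
  continuous : Continuous hom
  commutes : ∀ r : IntRing L, hom (algebraMap (IntRing L) A r) = intRingMap L E r

/-- A free `G`-representation `𝒱` on `Spf A` is pointwise constant mod `p^n`: for every finite
extension `E` of `L`, the isomorphism class of the `𝒪_E/π_E^{γ_{E/L}(n)}`-linear representation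
`𝒱_y/π_E^{γ_{E/L}(n)}` of `G` does not depend on the `E`-rig-point `y`. -/
def IsPointwiseConstLattice {A : FormalAlg L} (𝒱 : Rep.{u} A G) (n : ℕ) : Prop :=
  ∀ (E : Type u) [NormedField E] [IsUltrametricDist E] [NormedAlgebra L E]
    [FiniteDimensional L E] (y y' : RigPoint A E),
    RepIso
      (extScalars (Ideal.Quotient.mk (maximalIdeal (IntRing E) ^ gam L E n)) (extScalars y.hom 𝒱))
      (extScalars (Ideal.Quotient.mk (maximalIdeal (IntRing E) ^ gam L E n)) (extScalars y'.hom 𝒱))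

/-- A free `G`-representation `𝒱` on `Spf A` is constant mod `π_L^n`: there is a free
`𝒪_L/π_L^n`-module `W` of finite rank with a linear action of `G` such that `𝒱/π_L^n` is
isomorphic to `W ⊗ A/π_L^n A`, `G`-equivariantly. -/
def IsConstLattice {A : FormalAlg L} (𝒱 : Rep.{u} A G) (n : ℕ) : Prop :=
  let J : Ideal (IntRing L) := maximalIdeal (IntRing L) ^ n
  let JA : Ideal A := J.map (algebraMap (IntRing L) A)
  ∃ W : Rep.{u} (IntRing L ⧸ J) G,
    Module.Free (IntRing L ⧸ J) W ∧ Module.Finite (IntRing L ⧸ J) W ∧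
    RepIso (extScalars (Ideal.Quotient.mk JA) 𝒱)
      (extScalars (Ideal.quotientMap JA (algebraMap (IntRing L) A) Ideal.le_comap_map) W)

/-- A `G`-representation on `X` is pointwise constant mod `p^n` if it admits a free lattice, over
some affine formal model of `X`, which is. -/
def IsPointwiseConst {X : RigidFunctor L} (V : Rep.{w} (GlobalFun X) G) (n : ℕ) : Prop :=
  ∃ (𝒳 : AffineFormalModel X) (𝒱 : Rep.{u} 𝒳.A G), IsLattice 𝒳 𝒱 V ∧ IsPointwiseConstLattice 𝒱 n

/-- A `G`-representation on `X` is constant mod `π_L^n` if it admits a free lattice, over some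
affine formal model of `X`, which is. -/
def IsConst {X : RigidFunctor L} (V : Rep.{w} (GlobalFun X) G) (n : ℕ) : Prop :=
  ∃ (𝒳 : AffineFormalModel X) (𝒱 : Rep.{u} 𝒳.A G), IsLattice 𝒳 𝒱 V ∧ IsConstLattice 𝒱 n

end Spaces

end RigidLattice

end

noncomputable section

namespace RigidLattice

/-! ### Commutative algebra -/

/-! Let `ϖ` be a uniformizer of `L`, so that `|ϖ|^k = p^{-k/e}`, and let `f_i` be finitely many
generators of `I_x`. Elements of `A` have absolute value at most `1` at all points, so bounds on the
`f_i` extend to `I_x`: `U` is given by `|f_i| < |ϖ|^{n-1}` and `V` by `|f_i| ≤ |ϖ|^n`. Both have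
dilatations as formal models: adjoin `ξ_i = f_i/ϖ^m` to `A` (`m = n-1`, resp. `m = n`) and complete,
for `U` along an ideal that also contains the `ξ_i`, so that they become topologically nilpotent.
The required lattice is the base change of the given one along `ι : A → B`.

Constancy is then formal. Each `a ∈ A` is congruent to the constant `a(x) ∈ 𝒪_L` modulo `I_x`, so
the base change becomes that of the fibre at `x` modulo any ideal containing `ι(I_x)`. For `V`,
`ι(f_i) = ϖ^n ξ_i ∈ ϖ^n B`. For `U`, a point `B → 𝒪_E` sends `ι(f_i) = ϖ^{n-1} ξ_i` into
`𝔪_E^{(n-1)e_{E/L}} · 𝔪_E`, which is the power with exponent `γ_{E/L}(n)`.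

The main work is to show that `B` has the right generic fibre (`exists_model_normLocus`). For a map
`Sp C → X` into the neighbourhood, `g = f_i/ϖ^m` has absolute value at most `1` (less than `1` for
`U`) at every point of `Sp C`; extending `A → C` to `B` requires `g` to be power-bounded
(topologically nilpotent for `U`) in `C`. This is `AffinoidAlg.exists_bound_pow`. It uses a bounded
noetherian integral model `R` of `C` and the subring of `C[1/g]` generated by `1/g` over `R`: either
this ring yields an equation for `g` (integrality over `R`, or `g^N ∈ ϖR[g]`), or it has a point
with `|g| > 1` (resp. `|g| ≥ 1`). Points come from `exists_prime_finite_quotient`: modulo an ideal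
maximal among those containing no power of `ϖ`, the ring is finite over `𝒪_L`, by Krull's principal
ideal theorem and Nakayama's lemma over a complete base. -/

theorem isPrecomplete_pi_fin {O : Type*} [CommRing O] (I : Ideal O) [IsPrecomplete I O] (n : ℕ) :
    IsPrecomplete I (Fin n → O) where
  prec' f hf := by
    have key : ∀ i : Fin n, ∃ L : O, ∀ k, f k i ≡ L [SMOD (I ^ k • ⊤ : Submodule O O)] := by
      intro i
      refine IsPrecomplete.prec' (I := I) (fun k => f k i) fun {k l} hkl => ?_
      have h := (hf hkl).map (LinearMap.proj (R := O) (φ := fun _ : Fin n => O) i)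
      refine SModEq.mono ?_ h
      rw [Submodule.map_smul'']
      exact Submodule.smul_mono le_rfl le_top
    choose L hL using key
    refine ⟨L, fun k => ?_⟩
    rw [SModEq.sub_mem]
    have hsum : f k - L = ∑ i, (f k i - L i) • (Pi.single i (1 : O) : Fin n → O) := by
      ext j
      simp [Finset.sum_apply, Pi.single_apply]
    rw [hsum]
    refine Submodule.sum_mem _ fun i _ => Submodule.smul_mem_smul ?_ trivial
    have := SModEq.sub_mem.1 (hL i k)
    simpa using this

/-- Nakayama's lemma over a complete base ring. -/
theorem finite_of_finite_quotient {O D : Type*} [CommRing O] [AddCommGroup D] [Module O D]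
    (I : Ideal O) [IsPrecomplete I O] [IsHausdorff I D]
    [Module.Finite O (D ⧸ (I • ⊤ : Submodule O D))] : Module.Finite O D := by
  obtain ⟨n, s, hs⟩ := Module.Finite.exists_fin (R := O) (M := D ⧸ (I • ⊤ : Submodule O D))
  choose t ht using fun i => Submodule.mkQ_surjective (I • ⊤ : Submodule O D) (s i)
  have := isPrecomplete_pi_fin I n
  refine Module.Finite.of_surjective (Fintype.linearCombination O t)
    (surjective_of_mkQ_comp_surjective (I := I) ?_)
  intro y
  have hy : y ∈ Submodule.span O (Set.range s) := hs ▸ trivial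
  obtain ⟨c, rfl⟩ := (Submodule.mem_span_range_iff_exists_fun O).1 hy
  refine ⟨c, ?_⟩
  simp [Fintype.linearCombination_apply, ht, -Submodule.mkQ_apply]

/-- A ring that is complete for a finitely generated ideal is noetherian if a noetherian ring
surjects onto the quotient. -/
theorem isNoetherianRing_of_isAdicComplete {P B : Type*} [CommRing P] [CommRing B]
    [IsNoetherianRing P] (φ : P →+* B) (I : Ideal B) (hI : I.FG) [IsAdicComplete I B]
    (h : Function.Surjective ((Ideal.Quotient.mk I).comp φ)) : IsNoetherianRing B := by
  obtain ⟨n, s, rfl⟩ := Submodule.fg_iff_exists_fin_generating_family.1 hI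
  set I : Ideal B := Ideal.span (Set.range s) with hIdef
  let J := MvPolynomial.idealOfVars (Fin n) P
  let ev : MvPolynomial (Fin n) P →+* B := MvPolynomial.eval₂Hom φ s
  have hJ : J.map ev = I := by
    change Ideal.map ev (Ideal.span (Set.range MvPolynomial.X)) = _
    rw [Ideal.map_span, ← Set.range_comp, hIdef]
    congr 2
    ext i
    simp [ev]
  have hJk (k : ℕ) : J ^ k ≤ (I ^ k).comap ev := by
    rw [← hJ, ← Ideal.map_pow]
    exact Ideal.le_comap_map
  -- This completion is a power series ring over `P`, hence noetherian. The map `F : Q → B` below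
  -- sends the variables to the generators `s`; its surjectivity need only be checked modulo `I`.
  let Q := AdicCompletion J (MvPolynomial (Fin n) P)
  have : IsNoetherianRing Q := isNoetherianRing_of_ringEquiv (MvPowerSeries (Fin n) P)
    (MvPowerSeries.toAdicCompletionAlgEquiv (Fin n) P).toRingEquiv
  let f (k : ℕ) : Q →+* B ⧸ I ^ k :=
    (Ideal.quotientMap (I ^ k) ev (hJk k)).comp (AdicCompletion.evalₐ J k).toRingHom
  have hf {k l : ℕ} (hkl : k ≤ l) :
      (Ideal.Quotient.factorPow I hkl).comp (f l) = f k := by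
    ext x
    obtain ⟨y, rfl⟩ := AdicCompletion.mk_surjective J _ x
    have hx (i : ℕ) : f i (AdicCompletion.mk J _ y) = Ideal.Quotient.mk (I ^ i) (ev (y i)) := by
      simp only [f, RingHom.comp_apply, AlgHom.toRingHom_eq_coe, RingHom.coe_coe]
      erw [AdicCompletion.evalₐ_mk, Ideal.quotientMap_mk]
    rw [RingHom.comp_apply, hx, hx]
    change Ideal.Quotient.mk _ _ = _
    rw [Ideal.Quotient.mk_eq_mk_iff_sub_mem, ← map_sub]
    refine hJk k ?_
    have := SModEq.sub_mem.1 (y.2 hkl)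
    rw [← neg_mem_iff, neg_sub]
    simpa using this
  let F : Q →+* B := IsAdicComplete.liftRingHom I f hf
  have hF (p : MvPolynomial (Fin n) P) : F (algebraMap _ Q p) = ev p := by
    rw [IsHausdorff.eq_iff_smodEq (I := I)]
    intro k
    rw [SModEq.sub_mem]
    simp only [smul_eq_mul, Ideal.mul_top]
    rw [← Ideal.Quotient.mk_eq_mk_iff_sub_mem, IsAdicComplete.mk_liftRingHom]
    simp only [f, RingHom.comp_apply, AlgHom.toRingHom_eq_coe, RingHom.coe_coe, AlgHom.commutes]
    simp
  have hmap : (J.map (algebraMap _ Q)).map F = I := by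
    rw [Ideal.map_map, ← hJ]
    congr 1
    ext p <;> simp [hF]
  have : IsAdicComplete (J.map (algebraMap _ Q)) Q := by
    rw [IsAdicComplete.map_algebraMap_iff]
    exact AdicCompletion.isAdicComplete (MvPolynomial.idealOfVars_fg _ _)
  have : IsHausdorff ((J.map (algebraMap _ Q)).map F) B := by rw [hmap]; infer_instance
  refine isNoetherianRing_of_surjective Q B F
    (surjective_of_mk_map_comp_surjective (I := J.map (algebraMap _ Q)) F ?_)
  rw [hmap]
  intro y
  obtain ⟨p, rfl⟩ := h y
  refine ⟨algebraMap (MvPolynomial (Fin n) P) Q (MvPolynomial.C p), ?_⟩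
  rw [RingHom.comp_apply, hF, RingHom.comp_apply]
  simp [ev]
  rfl

/-- In a noetherian domain in which every nonzero ideal contains a power of `a ≠ 0`, the prime
ideals containing `a` are maximal. -/
theorem isMaximal_of_forall_mem_pow {D : Type*} [CommRing D] [IsDomain D] [IsNoetherianRing D]
    {a : D} (ha : a ≠ 0) (h : ∀ J : Ideal D, J ≠ ⊥ → ∃ n : ℕ, a ^ n ∈ J) (q : Ideal D) [q.IsPrime]
    (haq : a ∈ q) : q.IsMaximal := by
  have hmem (p : Ideal D) (hp : p.IsPrime) (h0 : p ≠ ⊥) : a ∈ p := by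
    obtain ⟨n, hn⟩ := h p h0
    exact hp.mem_of_pow_mem n hn
  have hspan (p : Ideal D) (hp : p.IsPrime) (h0 : p ≠ ⊥) : Ideal.span {a} ≤ p := by
    rw [Ideal.span_singleton_le_iff_mem]
    exact hmem p hp h0
  have hmin (p : Ideal D) (hp : p ∈ (Ideal.span {a}).minimalPrimes) : p ≠ ⊥ := by
    rintro rfl
    exact ha (by simpa using hp.1.2)
  obtain ⟨M, hM, hqM⟩ := Ideal.exists_le_maximal q (Ideal.IsPrime.ne_top ‹_›)
  suffices hq : q = M from hq ▸ hM
  -- A nonzero `x ∈ M` lies in a prime `p'` of height at most one. This contains `a`, hence a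
  -- minimal prime `p ≠ 0` of `(a)`, and the height leaves no room for `p < p'`. Prime avoidance
  -- then puts `M` inside a single minimal prime of `(a)`.
  have hcover : (M : Set D) ⊆ ⋃ p ∈ (Ideal.span {a}).minimalPrimes, (p : Set D) := by
    intro x hx
    have := hM.isPrime
    obtain ⟨p, hp, hpM⟩ : ∃ p ∈ (Ideal.span {a}).minimalPrimes, x ∈ p := by
      by_cases hx0 : x = 0
      · obtain ⟨p, hp, -⟩ := Ideal.exists_minimalPrimes_le (hspan q ‹_›
          (fun h0 => ha (by simpa [h0] using haq)))
        exact ⟨p, hp, hx0 ▸ p.zero_mem⟩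
      obtain ⟨p', hp', -⟩ := Ideal.exists_minimalPrimes_le
        ((Ideal.span_singleton_le_iff_mem M).2 hx)
      have hxp : x ∈ p' := by simpa using hp'.1.2
      have hp1 := Ideal.height_le_one_of_isPrincipal_of_mem_minimalPrimes _ p' hp'
      have : p'.IsPrime := hp'.1.1
      have hp0 : p' ≠ ⊥ := fun h0 => hx0 (by simpa [h0] using hxp)
      obtain ⟨p, hp, hpp⟩ := Ideal.exists_minimalPrimes_le (hspan p' ‹_› hp0)
      have : p.IsPrime := hp.1.1
      refine ⟨p, hp, ?_⟩
      rcases hpp.eq_or_lt with rfl | hlt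
      · exact hxp
      have h1 := Ideal.height_add_one_le_of_lt_of_isPrime hlt
      have h2 := Ideal.height_add_one_le_of_lt_of_isPrime (bot_lt_iff_ne_bot.2 (hmin p hp))
      rw [Ideal.height_bot, zero_add] at h2
      have h3 : (1 : ℕ∞) + 1 ≤ 1 := (add_le_add_left h2 1).trans (h1.trans hp1)
      exact absurd h3 (by decide)
    exact Set.mem_biUnion hp hpM
  obtain ⟨p, hp, hMp⟩ := (Ideal.subset_union_prime_finite
    (Ideal.finite_minimalPrimes_of_isNoetherianRing D (Ideal.span {a})) ⊥ ⊥
    (fun p hp _ _ => hp.1.1)).1 hcover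
  obtain ⟨p', hp', hp'q⟩ := Ideal.exists_minimalPrimes_le (hspan q ‹_›
    (fun h0 => ha (by simpa [h0] using haq)))
  exact le_antisymm hqM (hMp.trans ((hp.2 hp'.1 (hp'q.trans (hqM.trans hMp))).trans hp'q))

/-- An artinian algebra whose residue fields are finite over the base ring is finite. -/
theorem finite_of_isFiniteLength {O R : Type*} [CommRing O] [CommRing R] [Algebra O R]
    (hR : ∀ m : Ideal R, m.IsMaximal → Module.Finite O (R ⧸ m)) {M : Type*} [AddCommGroup M]
    [Module R M] (hM : IsFiniteLength R M) [Module O M] [IsScalarTower O R M] :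
    Module.Finite O M := by
  revert ‹Module O M› ‹IsScalarTower O R M›
  induction hM with
  | of_subsingleton => intros; infer_instance
  | @of_simple_quotient M _ _ N hN _ ih =>
    intro _ _
    have h1 : Module.Finite O (N.restrictScalars O) := ih
    obtain ⟨I, hI, ⟨e⟩⟩ := isSimpleModule_iff_quot_maximal.1 hN
    have := hR I hI
    have h2 : Module.Finite O (M ⧸ N) :=
      Module.Finite.equiv (e.symm.restrictScalars O)
    have h3 : Module.Finite O (M ⧸ N.restrictScalars O) :=
      Module.Finite.equiv (Submodule.Quotient.restrictScalarsEquiv O N).symm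
    exact Module.Finite.of_submodule_quotient (N.restrictScalars O)

/-- Zariski's lemma: `R/m` is a field of finite type over the residue field `O/ϖ`, hence finite over
it. -/
theorem finite_quotient_of_isMaximal {O R : Type*} [CommRing O] [CommRing R] [Algebra O R]
    {ϖ : O} (hϖ : (Ideal.span {ϖ}).IsMaximal) (I : Ideal R) [Algebra.FiniteType O (R ⧸ I)]
    (hI : algebraMap O R ϖ ∈ I) (m : Ideal R) (hm : m.IsMaximal) (hIm : I ≤ m) :
    Module.Finite O (R ⧸ m) := by
  have : Algebra.FiniteType O (R ⧸ m) :=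
    Algebra.FiniteType.of_surjective (Ideal.Quotient.factorₐ O hIm)
      (Ideal.Quotient.factor_surjective hIm)
  let k := O ⧸ Ideal.span {ϖ}
  let _ : Field k := Ideal.Quotient.field _
  let _ : Field (R ⧸ m) := Ideal.Quotient.field _
  let _ : Algebra k (R ⧸ m) := (Ideal.Quotient.lift (Ideal.span {ϖ}) (algebraMap O (R ⧸ m)) (by
    intro a ha
    obtain ⟨b, rfl⟩ := Ideal.mem_span_singleton'.1 ha
    rw [map_mul]
    have : algebraMap O (R ⧸ m) ϖ = 0 := Ideal.Quotient.eq_zero_iff_mem.2 (hIm hI)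
    rw [this, mul_zero])).toAlgebra
  have : IsScalarTower O k (R ⧸ m) := IsScalarTower.of_algebraMap_eq fun _ => rfl
  have : Algebra.FiniteType k (R ⧸ m) := Algebra.FiniteType.of_restrictScalars_finiteType O k _
  have : Module.Finite k (R ⧸ m) := finite_of_finite_type_of_isJacobsonRing k (R ⧸ m)
  have : Module.Finite O k := Module.Finite.of_surjective
    (Algebra.linearMap O k) Ideal.Quotient.mk_surjective
  exact Module.Finite.trans k (R ⧸ m)

/-- A point of the generic fibre. -/
theorem exists_prime_finite_quotient {O R : Type*} [CommRing O] [CommRing R] [Algebra O R]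
    [IsNoetherianRing R] {ϖ : O} (hϖ : (Ideal.span {ϖ}).IsMaximal)
    [IsPrecomplete (Ideal.span {ϖ}) O] (I : Ideal R) [Algebra.FiniteType O (R ⧸ I)]
    (hI : algebraMap O R ϖ ∈ I) (hJ : I ≤ Ideal.jacobson ⊥)
    (hnil : ¬ IsNilpotent (algebraMap O R ϖ)) :
    ∃ q : Ideal R, q.IsPrime ∧ algebraMap O R ϖ ∉ q ∧ Module.Finite O (R ⧸ q) ∧
      ∀ a ∈ I, ∃ N : ℕ, a ^ N ∈ q ⊔ Ideal.span {algebraMap O R ϖ} := by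
  set a := algebraMap O R ϖ with hadef
  -- An ideal maximal among those containing no power of `ϖ` is prime; it is a closed point of `Spec
  -- R[1/ϖ]`. In `D = R/q` every nonzero ideal contains a power of `ϖ`.
  obtain ⟨q, hq, hmax⟩ := set_has_maximal_iff_noetherian.2 ‹IsNoetherianRing R›
    {J : Submodule R R | ∀ n : ℕ, a ^ n ∉ J} ⟨⊥, fun n hn => hnil ⟨n, by simpa using hn⟩⟩
  change Ideal R at q
  have hmax' (J : Ideal R) (hqJ : q < J) : ∃ n : ℕ, a ^ n ∈ J := by
    by_contra! hcon
    exact hmax J hcon hqJ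
  have hqp : q.IsPrime := by
    refine Ideal.isPrime_of_maximally_disjoint q (Submonoid.powers a) ?_ fun J hJ hd => ?_
    · rw [Set.disjoint_left]
      rintro x hx ⟨n, rfl⟩
      exact hq n hx
    · obtain ⟨n, hn⟩ := hmax' J hJ
      exact Set.disjoint_left.1 hd hn ⟨n, rfl⟩
  have haq : a ∉ q := fun h => hq 1 (by simpa using h)
  let D := R ⧸ q
  let b : D := Ideal.Quotient.mk q a
  have hb : b ≠ 0 := fun h => haq (Ideal.Quotient.eq_zero_iff_mem.1 h)
  have hbD : algebraMap O D ϖ = b := rfl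
  have hD (J : Ideal D) (hJ : J ≠ ⊥) : ∃ n : ℕ, b ^ n ∈ J := by
    obtain ⟨n, hn⟩ := hmax' (J.comap (Ideal.Quotient.mk q)) (by
      refine lt_of_le_of_ne ?_ ?_
      · conv_lhs => rw [← Ideal.mk_ker (I := q)]
        exact Ideal.ker_le_comap _
      · rintro h
        apply hJ
        rw [← Ideal.map_comap_of_surjective _ Ideal.Quotient.mk_surjective J, ← h,
          Ideal.map_quotient_self])
    exact ⟨n, by simpa using hn⟩
  let S := D ⧸ Ideal.span {b}
  -- So `D/ϖ` is artinian. Its residue fields are finite over `O`, hence so is `D/ϖ`, and then `D`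
  -- by Nakayama's lemma.
  have hkd : Ring.KrullDimLE 0 S := by
    refine Ring.KrullDimLE.mk₀ fun P hP => ?_
    have hPc := hP.comap (Ideal.Quotient.mk (Ideal.span {b}))
    have h1 := isMaximal_of_forall_mem_pow hb hD (q := P.comap (Ideal.Quotient.mk _))
      (by
        rw [Ideal.mem_comap, Ideal.Quotient.eq_zero_iff_mem.2 (Ideal.mem_span_singleton_self b)]
        exact P.zero_mem)
    rw [← Ideal.map_comap_of_surjective _ Ideal.Quotient.mk_surjective P]
    refine (Ideal.map_eq_top_or_isMaximal_of_surjective _ Ideal.Quotient.mk_surjective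
      h1).resolve_left ?_
    rw [Ideal.map_comap_of_surjective _ Ideal.Quotient.mk_surjective P]
    exact hP.ne_top
  have : IsArtinianRing S := isArtinianRing_iff_isNoetherianRing_krullDimLE_zero.2
    ⟨inferInstance, hkd⟩
  let f : R →ₐ[O] S := (Ideal.Quotient.mkₐ O (Ideal.span {b})).comp (Ideal.Quotient.mkₐ O q)
  have hf : Function.Surjective f :=
    Ideal.Quotient.mk_surjective.comp Ideal.Quotient.mk_surjective
  have hIf (m : Ideal S) (hm : m.IsMaximal) : I ≤ m.comap f :=
    hJ.trans (sInf_le ⟨bot_le, Ideal.comap_isMaximal_of_surjective f hf⟩)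
  have hS : Module.Finite O S := by
    refine finite_of_isFiniteLength (R := S) (fun m hm => ?_)
      (isFiniteLength_iff_isNoetherian_isArtinian.2 ⟨inferInstance, inferInstance⟩)
    have hmf : (m.comap f).IsMaximal := Ideal.comap_isMaximal_of_surjective f hf
    have := finite_quotient_of_isMaximal hϖ I hI (m.comap f) hmf (hIf m hm)
    exact Module.Finite.of_surjective (Ideal.quotientMapₐ m f le_rfl).toLinearMap
      (Ideal.quotientMap_surjective (f := (f : R →+* S)) (H := le_rfl) hf)
  refine ⟨q, hqp, haq, ?_, fun x hx => ?_⟩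
  · have hmap : (Ideal.span {ϖ}).map (algebraMap O D) = Ideal.span {b} := by
      rw [Ideal.map_span, Set.image_singleton, hbD]
    -- Separatedness of `D` comes from Krull's intersection theorem.
    have hjac : Ideal.span {b} ≤ Ideal.jacobson (⊥ : Ideal D) := by
      rw [Ideal.span_singleton_le_iff_mem]
      refine Submodule.mem_sInf.2 fun (m : Ideal D) hm => ?_
      have := hm.2
      have hc : (m.comap (Ideal.Quotient.mk q)).IsMaximal :=
        Ideal.comap_isMaximal_of_surjective _ Ideal.Quotient.mk_surjective
      exact hJ.trans (sInf_le ⟨bot_le, hc⟩) hI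
    have h1 : IsHausdorff (Ideal.span {ϖ}) D := by
      have := IsHausdorff.of_le_jacobson _ D hjac
      rw [← hmap] at this
      exact IsHausdorff.map_algebraMap_iff.1 this
    have h2 : Module.Finite O (D ⧸ (Ideal.span {ϖ} • ⊤ : Submodule O D)) := by
      rw [Ideal.smul_top_eq_map, hmap]
      exact Module.Finite.equiv (Submodule.Quotient.restrictScalarsEquiv O (Ideal.span {b})).symm
    exact finite_of_finite_quotient (Ideal.span {ϖ})
  -- The image of `I` lies in all maximal ideals of the artinian ring `S`, hence in a nilpotent
  -- ideal.
  · obtain ⟨N, hN⟩ := IsArtinianRing.isNilpotent_jacobson_bot (R := S)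
    have hfx : f x ∈ Ideal.jacobson (⊥ : Ideal S) :=
      Submodule.mem_sInf.2 fun m hm => hIf m hm.2 hx
    have h0 : f x ^ N = 0 := by
      have := Ideal.pow_mem_pow hfx N
      rwa [hN] at this
    rw [← map_pow] at h0
    have h1 : Ideal.Quotient.mk q (x ^ N) ∈ Ideal.span {b} := Ideal.Quotient.eq_zero_iff_mem.1 h0
    obtain ⟨c, hc⟩ := Ideal.mem_span_singleton'.1 h1
    obtain ⟨c, rfl⟩ := Ideal.Quotient.mk_surjective c
    rw [← map_mul, eq_comm, Ideal.Quotient.mk_eq_mk_iff_sub_mem] at hc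
    refine ⟨N, ?_⟩
    rw [← sub_add_cancel (x ^ N) (c * a)]
    exact Submodule.add_mem_sup hc (Ideal.mul_mem_left _ _ (Ideal.mem_span_singleton_self a))

/-- The multiplicative set `1 + I`. -/
def onePlus {R : Type*} [CommRing R] (I : Ideal R) : Submonoid R where
  carrier := {s | s - 1 ∈ I}
  one_mem' := by simp
  mul_mem' {a b} ha hb := by
    have : a * b - 1 = (a - 1) * b + (b - 1) := by ring
    change a * b - 1 ∈ I
    rw [this]
    exact I.add_mem (I.mul_mem_right _ ha) hb

/-- Localizing at `1 + I` moves `I` into the Jacobson radical and does not change `R/I`. The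
preceding theorem then applies unless `ϖ` becomes nilpotent, which, read in `R`, is the first
alternative. -/
theorem exists_point {O : Type v} {R : Type u} [CommRing O] [CommRing R] [Algebra O R]
    [IsNoetherianRing R] {ϖ : O} (hϖ : (Ideal.span {ϖ}).IsMaximal)
    [IsPrecomplete (Ideal.span {ϖ}) O] (I : Ideal R) [Algebra.FiniteType O (R ⧸ I)]
    (hI : algebraMap O R ϖ ∈ I) :
    (∃ s : R, s - 1 ∈ I ∧ ∃ N : ℕ, s * algebraMap O R ϖ ^ N = 0) ∨
    ∃ (D : Type u) (_ : CommRing D) (_ : IsDomain D) (_ : Algebra O D) (φ : R →ₐ[O] D),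
      Module.Finite O D ∧ algebraMap O D ϖ ≠ 0 ∧
      ∀ a ∈ I, ∃ N : ℕ, algebraMap O D ϖ ∣ φ a ^ N := by
  let T := Localization (onePlus I)
  by_cases hnil : IsNilpotent (algebraMap O T ϖ)
  · left
    obtain ⟨N, hN⟩ := hnil
    rw [IsScalarTower.algebraMap_apply O R T, ← map_pow,
      IsLocalization.map_eq_zero_iff (onePlus I)] at hN
    obtain ⟨s, hs⟩ := hN
    exact ⟨s, s.2, N, hs⟩
  right
  let J : Ideal T := I.map (algebraMap R T)
  have hJ : J ≤ Ideal.jacobson ⊥ := by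
    intro x hx
    rw [Ideal.mem_jacobson_bot]
    intro y
    obtain ⟨⟨i, s⟩, his⟩ := (IsLocalization.mem_map_algebraMap_iff (onePlus I) T).1
      (J.mul_mem_right y hx)
    have hi : (i : R) + s ∈ onePlus I := by
      change (i : R) + s - 1 ∈ I
      rw [add_sub_assoc]
      exact I.add_mem i.2 s.2
    have h1 := IsLocalization.map_units T (⟨_, hi⟩ : onePlus I)
    refine isUnit_of_mul_isUnit_left (y := algebraMap R T s) ?_
    rw [add_mul, his, one_mul, ← map_add]
    exact h1
  have hsurj : Function.Surjective ((Ideal.Quotient.mk J).comp (algebraMap R T)) := by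
    intro z
    obtain ⟨z, rfl⟩ := Ideal.Quotient.mk_surjective z
    obtain ⟨⟨r, s⟩, hrs⟩ := IsLocalization.surj (onePlus I) z
    refine ⟨r, ?_⟩
    rw [RingHom.comp_apply, Ideal.Quotient.mk_eq_mk_iff_sub_mem]
    have : algebraMap R T r - z = z * algebraMap R T (s - 1) := by
      rw [map_sub, map_one, mul_sub, mul_one, ← hrs]
    rw [this]
    exact J.mul_mem_left _ (Ideal.mem_map_of_mem _ s.2)
  have : Algebra.FiniteType O (T ⧸ J) := by
    refine Algebra.FiniteType.of_surjective (Ideal.quotientMapₐ J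
      (IsScalarTower.toAlgHom O R T) Ideal.le_comap_map) fun z => ?_
    obtain ⟨r, rfl⟩ := hsurj z
    exact ⟨Ideal.Quotient.mk I r, rfl⟩
  have : IsNoetherianRing T := IsLocalization.isNoetherianRing (onePlus I) T inferInstance
  obtain ⟨q, hq, h0, hfin, hN⟩ := exists_prime_finite_quotient hϖ J (by
    rw [IsScalarTower.algebraMap_apply O R T]
    exact Ideal.mem_map_of_mem _ hI) hJ hnil
  refine ⟨T ⧸ q, inferInstance, inferInstance, inferInstance,
    (Ideal.Quotient.mkₐ O q).comp (IsScalarTower.toAlgHom O R T), hfin,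
    fun h => h0 (Ideal.Quotient.eq_zero_iff_mem.1 h), fun a ha => ?_⟩
  obtain ⟨N, hN⟩ := hN _ (Ideal.mem_map_of_mem (algebraMap R T) ha)
  refine ⟨N, ?_⟩
  obtain ⟨y, hy, z, hz, hyz⟩ := Submodule.mem_sup.1 hN
  obtain ⟨c, rfl⟩ := Ideal.mem_span_singleton'.1 hz
  refine ⟨Ideal.Quotient.mk q c, ?_⟩
  change Ideal.Quotient.mk q (algebraMap R T a) ^ N = Ideal.Quotient.mk q (algebraMap O T ϖ) * _
  rw [← map_pow, ← hyz, map_add, Ideal.Quotient.eq_zero_iff_mem.2 hy, zero_add, map_mul, mul_comm]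

/-- A finite extension of a complete field is a normed field. -/
theorem exists_normedField (L : Type u) [NontriviallyNormedField L] [IsUltrametricDist L]
    [CompleteSpace L] (D : Type u) [CommRing D] [IsDomain D] [Algebra (IntRing L) D]
    [Module.Finite (IntRing L) D] {ϖ : IntRing L}
    (hϖm : ∀ r : L, ∃ N : ℕ, ‖(ϖ : L) ^ N * r‖ ≤ 1)
    (h0 : algebraMap (IntRing L) D ϖ ≠ 0) :
    ∃ (E : Type u) (_ : NormedField E) (_ : IsUltrametricDist E) (_ : NormedAlgebra L E)
      (_ : FiniteDimensional L E) (φ : D →+* E),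
      (∀ r : IntRing L, φ (algebraMap (IntRing L) D r) = algebraMap L E r) ∧
      ∀ d, ‖φ d‖ ≤ 1 := by
  let E := FractionRing D
  have hinj : Function.Injective (algebraMap (IntRing L) D) := by
    rw [injective_iff_map_eq_zero]
    intro r hr
    by_contra hr0
    have hrL : (r : L) ≠ 0 := by simpa using hr0
    -- Every nonzero `r` divides a power of `ϖ`, and no power of `ϖ` dies in the domain `D`.
    obtain ⟨N, hN⟩ := hϖm (r : L)⁻¹
    have : ϖ ^ N = (⟨_, mem_intRing.2 hN⟩ : IntRing L) * r := by
      ext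
      simp [mul_assoc, inv_mul_cancel₀ hrL]
    have h1 := congrArg (algebraMap (IntRing L) D) this
    rw [map_mul, hr, mul_zero, map_pow] at h1
    exact h0 (pow_eq_zero_iff (fun h => by simp [h] at h1) |>.1 h1)
  let _ : Algebra L E := (IsFractionRing.lift (A := IntRing L) (K := L)
    (g := (algebraMap D E).comp (algebraMap (IntRing L) D))
    ((IsFractionRing.injective D E).comp hinj)).toAlgebra
  have halg (r : IntRing L) : algebraMap L E r = algebraMap D E (algebraMap (IntRing L) D r) :=
    IsFractionRing.lift_algebraMap (A := IntRing L) (K := L) _ r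
  have : IsScalarTower (IntRing L) L E := IsScalarTower.of_algebraMap_eq fun r => by
    exact (halg r).symm
  have : FaithfulSMul (IntRing L) D := (faithfulSMul_iff_algebraMap_injective _ _).2 hinj
  have hfin : FiniteDimensional L E := by
    obtain ⟨_, s, hs⟩ := Module.Finite.exists_fin (R := IntRing L) (M := D)
    exact Module.finite_def.mpr <|
      (span_eq_top_localization_localization L (nonZeroDivisors (IntRing L)) E hs) ▸
        Submodule.fg_span (Set.toFinite _)
  let _ : NormedField E := spectralNorm.normedField L E
  let _ : NormedAlgebra L E := spectralNorm.normedAlgebra L E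
  have hult : IsUltrametricDist E := IsUltrametricDist.isUltrametricDist_of_isNonarchimedean_norm
    (isNonarchimedean_spectralNorm (K := L) (L := E))
  refine ⟨E, inferInstance, hult, inferInstance, hfin, algebraMap D E, fun r => (halg r).symm,
    fun d => ?_⟩
  obtain ⟨p, hp, hpd⟩ := Algebra.IsIntegral.isIntegral (R := IntRing L) d
  -- Elements of `D` are integral over `𝒪_L`, hence lie in the valuation ring of `E`, which is
  -- integrally closed.
  have hint : IsIntegral (IntRing E) (algebraMap D E d) := by
    refine ⟨p.map (intRingMap L E), hp.map _, ?_⟩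
    rw [Polynomial.eval₂_map]
    have h1 := congrArg (algebraMap D E) hpd
    rw [map_zero, Polynomial.hom_eval₂] at h1
    rw [← h1]
    congr 1
    ext r
    exact halg r
  obtain ⟨y, hy⟩ := IsIntegrallyClosed.isIntegral_iff.1 hint
  rw [← hy]
  exact mem_intRing.1 y.2

open Polynomial in
-- Clearing denominators in `q(1/g) = 0` gives the reversed polynomial at `g`; the factor `g ^ k`
-- accounts for the kernel of `Q → Q[1/g]`.
theorem pow_mul_aeval_reflect_eq_zero {R Q : Type*} [CommRing R] [CommRing Q] [Algebra R Q] (g : Q)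
    (q : R[X]) (h : aeval (IsLocalization.Away.invSelf g : Localization.Away g) q = 0) :
    ∃ k : ℕ, g ^ k * aeval g (reflect q.natDegree q) = 0 := by
  let x := algebraMap Q (Localization.Away g) g
  have hx : x * IsLocalization.Away.invSelf g = 1 := IsLocalization.Away.mul_invSelf g
  let _ : Invertible x := ⟨IsLocalization.Away.invSelf g, by rw [mul_comm, hx], hx⟩
  have h1 := eval₂_reflect_mul_pow (algebraMap R (Localization.Away g)) x q.natDegree
    (reflect q.natDegree q) ((natDegree_reflect_le (N := q.natDegree) (p := q)).trans (by simp))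
  rw [reflect_reflect] at h1
  have h2 : eval₂ (algebraMap R (Localization.Away g)) (⅟x) q = 0 := h
  rw [h2, zero_mul] at h1
  have h3 : algebraMap Q (Localization.Away g) (aeval g (reflect q.natDegree q)) = 0 := by
    rw [← aeval_algebraMap_apply]
    exact h1.symm
  obtain ⟨⟨_, k, rfl⟩, hk⟩ := (IsLocalization.map_eq_zero_iff (Submonoid.powers g) _ _).1 h3
  exact ⟨k, hk⟩

/-! ### Integral equations for `g`, or points where `1/g` is integral -/

section
open Polynomial

variable {O : Type v} {R : Type u} [CommRing O] [CommRing R] [Algebra O R]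
    [IsNoetherianRing R] {ϖ : O} (hϖ : (Ideal.span {ϖ}).IsMaximal)
    [IsPrecomplete (Ideal.span {ϖ}) O] [Algebra.FiniteType O (R ⧸ Ideal.span {algebraMap O R ϖ})]
    {Q : Type u} [CommRing Q] [Algebra R Q] (hunit : IsUnit (algebraMap R Q (algebraMap O R ϖ)))

include hϖ hunit in
-- This is `exists_point` for the subring `R[X]/K` of `Q[1/g]` generated by `1/g`. Since `ϖ` is a
-- unit in `Q`, the first alternative there becomes a relation `1 = i(1/g)`. In the second, `t` is
-- the value of `1/g`; as `g` itself need not come from `R`, the equation `φ(g) t = 1` is expressed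
-- through elements `r = g ϖ^k`.
theorem exists_point_inv (g : Q) (I : Ideal R[X]) (hI : C (algebraMap O R ϖ) ∈ I) :
    (∃ i ∈ I, aeval (IsLocalization.Away.invSelf g : Localization.Away g) (1 - i) = 0) ∨
    ∃ (D : Type u) (_ : CommRing D) (_ : IsDomain D) (_ : Algebra O D) (φ : R →ₐ[O] D) (t : D),
      Module.Finite O D ∧ algebraMap O D ϖ ≠ 0 ∧
      (∀ (r : R) (k : ℕ), algebraMap R Q r = g * algebraMap R Q (algebraMap O R ϖ) ^ k →
        φ r * t = algebraMap O D ϖ ^ k) ∧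
      ∀ a ∈ I, ∃ N : ℕ, algebraMap O D ϖ ∣ eval₂ (φ : R →+* D) t a ^ N := by
  let s : Localization.Away g := IsLocalization.Away.invSelf g
  let K : Ideal R[X] := RingHom.ker (aeval (R := R) s)
  let T := R[X] ⧸ K
  let J : Ideal T := I.map (Ideal.Quotient.mk K)
  let m : R[X] →ₐ[O] T := Ideal.Quotient.mkₐ O K
  have hϖJ : algebraMap O T ϖ ∈ J := Ideal.mem_map_of_mem _ hI
  have hft : Algebra.FiniteType O (T ⧸ J) := by
    have : Algebra.FiniteType O (R ⧸ Ideal.span {algebraMap O R ϖ})[X] :=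
      Algebra.FiniteType.trans ‹_› inferInstance
    let f : R[X] →ₐ[O] T ⧸ J := (Ideal.Quotient.mkₐ O J).comp m
    have hf : Function.Surjective f :=
      Ideal.Quotient.mk_surjective.comp Ideal.Quotient.mk_surjective
    let f0 : (R ⧸ Ideal.span {algebraMap O R ϖ}) →ₐ[O] T ⧸ J :=
      Ideal.Quotient.liftₐ _ (f.comp (IsScalarTower.toAlgHom O R R[X])) (by
        intro a ha
        obtain ⟨b, rfl⟩ := Ideal.mem_span_singleton'.1 ha
        rw [map_mul]
        convert mul_zero _
        exact Ideal.Quotient.eq_zero_iff_mem.2 hϖJ)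
    refine Algebra.FiniteType.of_surjective (aevalTower f0 (f X)) ?_
    intro y
    obtain ⟨p, rfl⟩ := hf y
    refine ⟨p.map (Ideal.Quotient.mk _), ?_⟩
    change eval₂ (f0 : (R ⧸ Ideal.span {algebraMap O R ϖ}) →+* T ⧸ J) (f X)
      (p.map (Ideal.Quotient.mk _)) = f p
    rw [eval₂_map]
    conv_rhs => rw [← eval₂_C_X (p := p)]
    change _ = (f : R[X] →+* T ⧸ J) _
    rw [hom_eval₂]
    rfl
  rcases exists_point hϖ J hϖJ with ⟨z, hz, N, hzN⟩ | ⟨D, i1, i2, i3, φ, hfin, h0, hN⟩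
  · left
    obtain ⟨q, rfl⟩ := Ideal.Quotient.mk_surjective z
    have hq : aeval s q = 0 := by
      have h1 : q * C (algebraMap O R ϖ) ^ N ∈ K := Ideal.Quotient.eq_zero_iff_mem.1 hzN
      have h2 : aeval s (q * C (algebraMap O R ϖ) ^ N) = 0 := h1
      rw [map_mul, map_pow, aeval_C, IsScalarTower.algebraMap_apply R Q] at h2
      exact ((hunit.map _).pow N).mul_left_eq_zero.1 h2
    obtain ⟨i, hi, hiq⟩ := (Ideal.mem_map_iff_of_surjective _ Ideal.Quotient.mk_surjective).1 hz
    refine ⟨-i, I.neg_mem hi, ?_⟩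
    have h3 : i - (q - 1) ∈ K := by
      rw [← Ideal.Quotient.mk_eq_mk_iff_sub_mem, hiq]
      simp
    have h4 : aeval s (i - (q - 1)) = 0 := h3
    rw [← h4]
    simp only [map_sub, map_one, map_neg, hq]
    change 1 - -(aeval s i) = aeval s i - (0 - 1)
    ring
  · right
    let Φ : R[X] →ₐ[O] D := φ.comp m
    have hΦ (p : R[X]) : Φ p = eval₂ ((Φ : R[X] →+* D).comp C) (Φ X) p := by
      conv_lhs => rw [← eval₂_C_X (p := p)]
      change (Φ : R[X] →+* D) _ = _
      rw [hom_eval₂]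
      rfl
    refine ⟨D, i1, i2, i3, Φ.comp (IsScalarTower.toAlgHom O R R[X]), Φ X, hfin, h0, ?_, ?_⟩
    · intro r k hrk
      have h1 : C r * X - C (algebraMap O R ϖ) ^ k ∈ K := by
        change aeval s _ = 0
        rw [map_sub, map_mul, aeval_C, aeval_X, map_pow, aeval_C, IsScalarTower.algebraMap_apply R Q,
          hrk, IsScalarTower.algebraMap_apply R Q, map_mul, map_pow]
        have hx : algebraMap Q (Localization.Away g) g * s = 1 :=
          IsLocalization.Away.mul_invSelf g
        linear_combination (algebraMap Q (Localization.Away g)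
          (algebraMap R Q (algebraMap O R ϖ))) ^ k * hx
      have h2 : m (C r * X - C (algebraMap O R ϖ) ^ k) = 0 := Ideal.Quotient.eq_zero_iff_mem.2 h1
      have h3 : Φ (C r * X - C (algebraMap O R ϖ) ^ k) = 0 := by
        change φ (m _) = 0
        rw [h2, map_zero]
      rw [map_sub, map_mul, map_pow, sub_eq_zero] at h3
      have h4 : Φ (C (algebraMap O R ϖ)) = algebraMap O D ϖ := Φ.commutes ϖ
      rw [h4] at h3
      exact h3
    · intro a ha
      obtain ⟨N, hN⟩ := hN _ (Ideal.mem_map_of_mem _ ha)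
      exact ⟨N, by convert hN using 2; exact (hΦ a).symm⟩

include hϖ hunit in
-- Take the ideal `(ϖ, X)`. A relation `(1 - i)(1/g) = 0` has constant term in `1 + ϖR`, a unit
-- because `ϖ` is in the Jacobson radical; reversing makes it the leading coefficient of an equation
-- for `g`. Otherwise some power of `t = 1/g` is divisible by `ϖ` at a point, so that `|g| > 1`
-- there.
theorem isIntegral_or_exists_point (hjac : algebraMap O R ϖ ∈ Ideal.jacobson (⊥ : Ideal R)) (g : Q) :
    IsIntegral R g ∨
    ∃ (D : Type u) (_ : CommRing D) (_ : IsDomain D) (_ : Algebra O D) (φ : R →ₐ[O] D) (t : D),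
      Module.Finite O D ∧ algebraMap O D ϖ ≠ 0 ∧
      (∀ (r : R) (k : ℕ), algebraMap R Q r = g * algebraMap R Q (algebraMap O R ϖ) ^ k →
        φ r * t = algebraMap O D ϖ ^ k) ∧ ∃ N : ℕ, algebraMap O D ϖ ∣ t ^ N := by
  rcases exists_point_inv hϖ hunit g (Ideal.span {C (algebraMap O R ϖ)} ⊔ Ideal.span {X})
    (Ideal.mem_sup_left (Ideal.mem_span_singleton_self _)) with ⟨i, hi, h⟩ |
    ⟨D, i1, i2, i3, φ, t, hfin, h0, hr, hN⟩
  · left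
    obtain ⟨k, hk⟩ := pow_mul_aeval_reflect_eq_zero g _ h
    set q : R[X] := 1 - i with hq
    set m := q.natDegree
    have hunit0 : IsUnit (q.coeff 0) := by
      obtain ⟨y, hy, z, hz, rfl⟩ := Submodule.mem_sup.1 hi
      obtain ⟨y, rfl⟩ := Ideal.mem_span_singleton'.1 hy
      obtain ⟨z, rfl⟩ := Ideal.mem_span_singleton'.1 hz
      have := (Ideal.mem_jacobson_bot.1 hjac) (-y.coeff 0)
      simp only [hq, coeff_sub, coeff_one_zero, coeff_add, mul_coeff_zero, coeff_C_zero,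
        coeff_X_zero, mul_zero, add_zero]
      convert this using 1
      ring
    obtain ⟨b, hb⟩ := hunit0
    refine ⟨C (↑b⁻¹ : R) * (X ^ k * reflect m q), ?_, ?_⟩
    · refine monic_of_natDegree_le_of_coeff_eq_one (m + k) ?_ ?_
      · refine (natDegree_C_mul_le _ _).trans ?_
        refine natDegree_mul_le.trans ?_
        rw [add_comm]
        exact add_le_add (natDegree_reflect_le.trans (by simp [m])) (natDegree_X_pow_le k)
      · rw [coeff_C_mul, coeff_X_pow_mul, coeff_reflect, revAt_le le_rfl, Nat.sub_self, ← hb]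
        simp
    · change aeval g _ = 0
      rw [map_mul, map_mul, map_pow, aeval_X, hk, mul_zero]
  · right
    obtain ⟨N, hN⟩ := hN X (Ideal.mem_sup_right (Ideal.mem_span_singleton_self _))
    exact ⟨D, i1, i2, i3, φ, t, hfin, h0, hr, N, by simpa using hN⟩

include hϖ hunit in
-- Take the ideal `(ϖ)`. The relation now reads `1 = ϖ p(1/g)`, and multiplying by a power of `g`
-- puts `g ^ N` in `ϖR[g]`. At the point of the other alternative `1/g` is integral, so `|g| ≥ 1`.
theorem pow_eq_mul_or_exists_point (g : Q) :
    (∃ (N : ℕ) (p : R[X]), g ^ N = algebraMap R Q (algebraMap O R ϖ) * aeval g p) ∨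
    ∃ (D : Type u) (_ : CommRing D) (_ : IsDomain D) (_ : Algebra O D) (φ : R →ₐ[O] D) (t : D),
      Module.Finite O D ∧ algebraMap O D ϖ ≠ 0 ∧
      (∀ (r : R) (k : ℕ), algebraMap R Q r = g * algebraMap R Q (algebraMap O R ϖ) ^ k →
        φ r * t = algebraMap O D ϖ ^ k) := by
  rcases exists_point_inv hϖ hunit g (Ideal.span {C (algebraMap O R ϖ)})
    (Ideal.mem_span_singleton_self _) with ⟨i, hi, h⟩ |
    ⟨D, i1, i2, i3, φ, t, hfin, h0, hr, -⟩
  · left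
    obtain ⟨k, hk⟩ := pow_mul_aeval_reflect_eq_zero g _ h
    obtain ⟨p, rfl⟩ := Ideal.mem_span_singleton'.1 hi
    set m := (1 - p * C (algebraMap O R ϖ)).natDegree
    refine ⟨m + k, X ^ k * reflect m p, ?_⟩
    -- `reflect m` permutes exponents, so it is linear even if `p` has degree greater than `m`.
    have h1 : reflect m (1 - p * C (algebraMap O R ϖ)) =
        X ^ m - C (algebraMap O R ϖ) * reflect m p := by
      rw [reflect_sub, mul_comm p, reflect_C_mul, reflect_one]
    rw [h1, map_sub, map_pow, aeval_X, map_mul, aeval_C, mul_sub, sub_eq_zero] at hk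
    rw [pow_add, mul_comm, hk, map_mul, map_pow, aeval_X]
    ring
  · right
    exact ⟨D, i1, i2, i3, φ, t, hfin, h0, hr⟩

end

/-! ### Uniformizers -/

section Uniformizer

variable {L : Type u} [NormedField L] [IsUltrametricDist L]

theorem isUnit_intRing_iff {x : IntRing L} : IsUnit x ↔ ‖(x : L)‖ = 1 := by
  constructor
  · rintro ⟨u, rfl⟩
    refine le_antisymm (mem_intRing.1 (u : IntRing L).2) ?_
    have h1 : ‖((u : IntRing L) : L)‖ * ‖((↑u⁻¹ : IntRing L) : L)‖ = 1 := by
      rw [← norm_mul]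
      exact (congrArg (fun x : IntRing L => ‖(x : L)‖) (Units.mul_inv u)).trans norm_one
    have h2 := mem_intRing.1 (↑u⁻¹ : IntRing L).2
    rw [← h1]
    exact mul_le_of_le_one_right (norm_nonneg _) h2
  · intro h
    have h0 : (x : L) ≠ 0 := fun h0 => by simp [h0] at h
    refine IsUnit.of_mul_eq_one ⟨(x : L)⁻¹, mem_intRing.2 (by simp [h])⟩ ?_
    ext
    simp [h0]

theorem mem_maximalIdeal_intRing {x : IntRing L} : x ∈ maximalIdeal (IntRing L) ↔ ‖(x : L)‖ < 1 := by
  rw [mem_maximalIdeal, mem_nonunits_iff, isUnit_intRing_iff]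
  exact ⟨fun h => lt_of_le_of_ne (mem_intRing.1 x.2) h, fun h => h.ne⟩

/-- A uniformizer: an element of largest absolute value less than `1`. -/
structure IsUnif (ϖ : IntRing L) : Prop where
  ne_zero : (ϖ : L) ≠ 0
  norm_lt_one : ‖(ϖ : L)‖ < 1
  norm_le : ∀ x : L, ‖x‖ < 1 → ‖x‖ ≤ ‖(ϖ : L)‖

theorem mem_span_pow_iff {ϖ : IntRing L} (h0 : (ϖ : L) ≠ 0) (k : ℕ) (x : IntRing L) :
    x ∈ Ideal.span {ϖ} ^ k ↔ ‖(x : L)‖ ≤ ‖(ϖ : L)‖ ^ k := by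
  rw [Ideal.span_singleton_pow, Ideal.mem_span_singleton]
  constructor
  · rintro ⟨y, rfl⟩
    simpa using mul_le_of_le_one_right (by positivity) (mem_intRing.1 y.2)
  · intro h
    refine ⟨⟨(x : L) / (ϖ : L) ^ k, mem_intRing.2 ?_⟩, ?_⟩
    · rw [norm_div, norm_pow]
      exact div_le_one_of_le₀ h (by positivity)
    · ext
      simp [mul_div_cancel₀ _ (pow_ne_zero k h0)]

theorem IsUnif.maximalIdeal_eq {ϖ : IntRing L} (h : IsUnif ϖ) :
    maximalIdeal (IntRing L) = Ideal.span {ϖ} := by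
  ext x
  rw [mem_maximalIdeal_intRing, ← pow_one (Ideal.span {ϖ}), mem_span_pow_iff h.ne_zero, pow_one]
  exact ⟨h.norm_le x, fun hx => hx.trans_lt h.norm_lt_one⟩

theorem IsUnif.isMaximal {ϖ : IntRing L} (h : IsUnif ϖ) : (Ideal.span {ϖ}).IsMaximal := by
  rw [← h.maximalIdeal_eq]
  infer_instance

theorem IsUnif.norm_pos {ϖ : IntRing L} (h : IsUnif ϖ) : 0 < ‖(ϖ : L)‖ := norm_pos_iff.2 h.ne_zero

theorem IsUnif.tendsto {ϖ : IntRing L} (h : IsUnif ϖ) :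
    Filter.Tendsto (fun n => ‖(ϖ : L)‖ ^ n) Filter.atTop (nhds 0) :=
  tendsto_pow_atTop_nhds_zero_of_lt_one (norm_nonneg _) h.norm_lt_one

theorem IsUnif.exists_pow_lt {ϖ : IntRing L} (h : IsUnif ϖ) {ε : ℝ} (hε : 0 < ε) :
    ∃ n : ℕ, ‖(ϖ : L)‖ ^ n < ε := exists_pow_lt_of_lt_one hε h.norm_lt_one

theorem IsUnif.exists_norm_pow_mul_le {ϖ : IntRing L} (h : IsUnif ϖ) (r : L) :
    ∃ N : ℕ, ‖(ϖ : L) ^ N * r‖ ≤ 1 := by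
  obtain ⟨N, hN⟩ := h.exists_pow_lt (ε := (‖r‖ + 1)⁻¹) (by positivity)
  refine ⟨N, ?_⟩
  rw [norm_mul, norm_pow]
  calc ‖(ϖ : L)‖ ^ N * ‖r‖ ≤ (‖r‖ + 1)⁻¹ * (‖r‖ + 1) := by gcongr; linarith
    _ = 1 := inv_mul_cancel₀ (by positivity)

theorem IsUnif.isPrecomplete [CompleteSpace L] {ϖ : IntRing L} (h : IsUnif ϖ) :
    IsPrecomplete (Ideal.span {ϖ}) (IntRing L) where
  prec' f hf := by
    have hf' {m n : ℕ} (hmn : m ≤ n) : ‖(f m : L) - f n‖ ≤ ‖(ϖ : L)‖ ^ m := by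
      have := SModEq.sub_mem.1 (hf hmn)
      simp only [smul_eq_mul, Ideal.mul_top] at this
      exact (mem_span_pow_iff h.ne_zero m _).1 this
    have hc : CauchySeq fun n => (f n : L) := by
      refine cauchySeq_of_le_tendsto_0' (fun n => ‖(ϖ : L)‖ ^ n) (fun m n hmn => ?_) h.tendsto
      rw [dist_eq_norm]
      exact hf' hmn
    obtain ⟨l, hl⟩ := cauchySeq_tendsto_of_complete hc
    have hln (n : ℕ) : ‖(f n : L) - l‖ ≤ ‖(ϖ : L)‖ ^ n :=
      le_of_tendsto ((tendsto_const_nhds.sub hl).norm)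
        (Filter.eventually_atTop.2 ⟨n, fun k hk => hf' hk⟩)
    have hl1 : ‖l‖ ≤ 1 := by
      refine le_of_tendsto hl.norm (Filter.Eventually.of_forall fun n => mem_intRing.1 (f n).2)
    refine ⟨⟨l, mem_intRing.2 hl1⟩, fun n => ?_⟩
    rw [SModEq.sub_mem]
    simp only [smul_eq_mul, Ideal.mul_top]
    exact (mem_span_pow_iff h.ne_zero n _).2 (hln n)

end Uniformizer

/-- The open unit ball is also closed, hence compact, and the norm attains its maximum there. Then
`|p|` is a power of this maximum, whose exponent is the ramification index. -/
theorem exists_isUnif (p : ℕ) [hp : Fact p.Prime] (L : Type u) [NormedField L] [IsUltrametricDist L]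
    [NormedAlgebra ℚ_[p] L] [FiniteDimensional ℚ_[p] L] :
    ∃ ϖ : IntRing L, IsUnif ϖ ∧
      ∀ k : ℕ, (p : ℝ) ^ (-(k : ℝ) / (ramIdx ℚ_[p] L : ℝ)) = ‖(ϖ : L)‖ ^ k := by
  have : ProperSpace L := FiniteDimensional.proper ℚ_[p] L
  have hpL : ‖algebraMap ℚ_[p] L p‖ = (p : ℝ)⁻¹ := by rw [norm_algebraMap', Padic.norm_p]
  have hp1 : (1 : ℝ) < p := by exact_mod_cast hp.out.one_lt
  have hp0 : (p : ℝ)⁻¹ < 1 := inv_lt_one_of_one_lt₀ hp1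
  have hcomp : IsCompact (Metric.ball (0 : L) 1) :=
    Metric.isCompact_of_isClosed_isBounded (IsUltrametricDist.isClosed_ball 0 1) Metric.isBounded_ball
  obtain ⟨ϖ, hϖ, hmax⟩ := hcomp.exists_isMaxOn ⟨0, by simp⟩ (continuous_norm.continuousOn)
  have hϖ1 : ‖ϖ‖ < 1 := by simpa using hϖ
  have hle (x : L) (hx : ‖x‖ < 1) : ‖x‖ ≤ ‖ϖ‖ := hmax (by simpa using hx)
  have hϖ0 : 0 < ‖ϖ‖ := by
    have := hle _ (hpL ▸ hp0)
    rw [hpL] at this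
    exact lt_of_lt_of_le (by positivity) this
  let P : IntRing L := ⟨ϖ, mem_intRing.2 hϖ1.le⟩
  have hP : IsUnif P := ⟨norm_pos_iff.1 hϖ0, hϖ1, hle⟩
  refine ⟨P, hP, ?_⟩
  -- Take `e` least with `|ϖ|^{e+1} < 1/p`. If `|ϖ|^e > 1/p`, then `|p/ϖ^e|` would lie strictly
  -- between `|ϖ|` and `1`.
  obtain ⟨e, he⟩ : ∃ e : ℕ, ‖ϖ‖ ^ e = (p : ℝ)⁻¹ := by
    classical
    have hex : ∃ n, ‖ϖ‖ ^ (n + 1) < (p : ℝ)⁻¹ := by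
      obtain ⟨n, hn⟩ := exists_pow_lt_of_lt_one (show (0 : ℝ) < (p : ℝ)⁻¹ by positivity) hϖ1
      exact ⟨n, (pow_le_pow_of_le_one hϖ0.le hϖ1.le n.le_succ).trans_lt hn⟩
    refine ⟨Nat.find hex, ?_⟩
    have h2 : (p : ℝ)⁻¹ ≤ ‖ϖ‖ ^ Nat.find hex := by
      rcases Nat.eq_zero_or_pos (Nat.find hex) with h | h
      · rw [h, pow_zero]; exact hp0.le
      · have := Nat.find_min hex (Nat.sub_lt h one_pos)
        rwa [not_lt, show Nat.find hex - 1 + 1 = Nat.find hex from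
          Nat.sub_add_cancel h] at this
    refine le_antisymm ?_ h2
    by_contra! hlt
    have h3 := hle (algebraMap ℚ_[p] L p / ϖ ^ Nat.find hex) (by
      rw [norm_div, norm_pow, hpL]
      exact (div_lt_one (by positivity)).2 hlt)
    rw [norm_div, norm_pow, hpL, div_le_iff₀ (by positivity), ← pow_succ'] at h3
    exact absurd (Nat.find_spec hex) (not_lt.2 h3)
  have hram : ramIdx ℚ_[p] L = e := by
    let _ := (intRingMap ℚ_[p] L).toAlgebra
    have hpm : ‖(p : ℚ_[p])‖ < 1 := by rw [Padic.norm_p]; exact hp0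
    let P0 : IntRing ℚ_[p] := ⟨p, mem_intRing.2 hpm.le⟩
    have hmem (x : IntRing ℚ_[p]) : (algebraMap (IntRing ℚ_[p]) (IntRing L) x : L) =
      algebraMap ℚ_[p] L x := rfl
    refine Ideal.ramificationIdx'_spec ?_ ?_
    · rw [Ideal.map_le_iff_le_comap]
      intro x hx
      rw [mem_maximalIdeal_intRing] at hx
      rw [Ideal.mem_comap, hP.maximalIdeal_eq, mem_span_pow_iff hP.ne_zero, hmem, norm_algebraMap',
        he]
      have := (Padic.norm_lt_pow_iff_norm_le_pow_sub_one (x : ℚ_[p]) 0).1 (by simpa using hx)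
      simpa using this
    · intro hcon
      have h1 := hcon (Ideal.mem_map_of_mem _ (show P0 ∈ _ from mem_maximalIdeal_intRing.2 hpm))
      rw [hP.maximalIdeal_eq, mem_span_pow_iff hP.ne_zero, hmem] at h1
      change ‖algebraMap ℚ_[p] L p‖ ≤ ‖ϖ‖ ^ (e + 1) at h1
      rw [hpL, ← he, pow_succ] at h1
      have : 0 < ‖ϖ‖ ^ e := by positivity
      nlinarith
  have he0 : e ≠ 0 := by
    rintro rfl
    rw [pow_zero] at he
    exact hp0.ne he.symm
  intro k
  rw [hram]
  have he' : (p : ℝ) = (‖ϖ‖ ^ e)⁻¹ := by rw [he, inv_inv]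
  change _ = ‖ϖ‖ ^ k
  rw [he', ← Real.rpow_natCast, ← Real.rpow_neg hϖ0.le, ← Real.rpow_mul hϖ0.le, ← Real.rpow_natCast]
  congr 1
  have : (e : ℝ) ≠ 0 := by exact_mod_cast he0
  field_simp

/-! ### Affinoid algebras -/

section Affinoid

variable {L : Type u} [NormedField L] [IsUltrametricDist L]

/-- By Cohen's theorem it suffices to treat prime ideals. Nonzero elements divide powers of `ϖ`, so
these are `0` and `(ϖ)`. -/
theorem IsUnif.isNoetherianRing {ϖ : IntRing L} (h : IsUnif ϖ) : IsNoetherianRing (IntRing L) := by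
  refine IsNoetherianRing.of_prime fun P hP => ?_
  by_cases hϖ : ϖ ∈ P
  · have : Ideal.span {ϖ} = P :=
      h.isMaximal.eq_of_le hP.ne_top ((Ideal.span_singleton_le_iff_mem P).2 hϖ)
    exact ⟨{ϖ}, by simpa using this⟩
  · suffices hb : P = ⊥ from hb ▸ Submodule.fg_bot
    rw [eq_bot_iff]
    intro x hx
    by_contra hx0
    have hxL : (x : L) ≠ 0 := by simpa using hx0
    obtain ⟨N, hN⟩ := h.exists_norm_pow_mul_le (x : L)⁻¹
    have : ϖ ^ N = (⟨_, mem_intRing.2 hN⟩ : IntRing L) * x := by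
      ext
      simp [mul_assoc, inv_mul_cancel₀ hxL]
    exact hϖ (hP.mem_of_pow_mem N (this ▸ P.mul_mem_left _ hx))

variable (L) in
/-- The power series in the Tate algebra with coefficients in the valuation ring. -/
def TateInt (n : ℕ) : Subring (TateAlg L n) :=
  (MvPowerSeries.map (σ := Fin n) (IntRing L).subtype).range.comap (TateAlg L n).subtype

/-- The coefficients of an element of the Tate algebra. -/
abbrev tcoeff {n : ℕ} (t : Fin n →₀ ℕ) (f : TateAlg L n) : L :=
  MvPowerSeries.coeff t (f : MvPowerSeries (Fin n) L)

theorem mem_tateInt {n : ℕ} {f : TateAlg L n} : f ∈ TateInt L n ↔ ∀ t, ‖tcoeff t f‖ ≤ 1 := by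
  constructor
  · rintro ⟨g, hg⟩ t
    have : tcoeff t f = (MvPowerSeries.coeff t g : IntRing L) := by
      change MvPowerSeries.coeff t ((TateAlg L n).subtype f) = _
      rw [← hg]
      rfl
    rw [this]
    exact mem_intRing.1 (MvPowerSeries.coeff t g).2
  · intro h
    refine ⟨fun t => ⟨tcoeff t f, mem_intRing.2 (h t)⟩, ?_⟩
    ext t
    rfl

theorem mem_tateAlg {n : ℕ} {f : MvPowerSeries (Fin n) L} :
    f ∈ TateAlg L n ↔ ∀ ε : ℝ, 0 < ε → {t | ε ≤ ‖MvPowerSeries.coeff t f‖}.Finite := by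
  change MvPowerSeries.IsRestricted (fun _ => 1) f ↔ _
  rw [MvPowerSeries.IsRestricted, (Metric.nhds_basis_ball (x := (0 : ℝ))).tendsto_right_iff]
  refine forall₂_congr fun ε hε => ?_
  rw [Filter.eventually_cofinite]
  simp [Finsupp.prod]

theorem tcoeff_const_mul {n : ℕ} (a : L) (f : TateAlg L n) (t : Fin n →₀ ℕ) :
    tcoeff t (TateAlg.const L n a * f) = a * tcoeff t f := by
  change MvPowerSeries.coeff t (MvPowerSeries.C a * (f : MvPowerSeries (Fin n) L)) = _
  rw [MvPowerSeries.coeff_C_mul]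

variable (L) in
/-- The constants, as a ring homomorphism. -/
def tateIntConst (n : ℕ) : IntRing L →+* TateInt L n where
  toFun a := ⟨TateAlg.const L n a, ⟨MvPowerSeries.C a, MvPowerSeries.map_C _ _⟩⟩
  map_one' := by apply Subtype.ext; apply Subtype.ext; exact map_one (MvPowerSeries.C (σ := Fin n) (R := L))
  map_zero' := by apply Subtype.ext; apply Subtype.ext; exact map_zero (MvPowerSeries.C (σ := Fin n) (R := L))
  map_add' a b := by apply Subtype.ext; apply Subtype.ext; exact map_add (MvPowerSeries.C (σ := Fin n) (R := L)) (a : L) (b : L)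
  map_mul' a b := by apply Subtype.ext; apply Subtype.ext; exact map_mul (MvPowerSeries.C (σ := Fin n) (R := L)) (a : L) (b : L)

instance (n : ℕ) : Algebra (IntRing L) (TateInt L n) := (tateIntConst L n).toAlgebra

theorem tateInt_smul {n : ℕ} (a : IntRing L) (f : TateInt L n) :
    ((a • f : TateInt L n) : TateAlg L n) = TateAlg.const L n a * f := rfl

theorem exists_eq_pow_smul {n : ℕ} {ϖ : IntRing L} (h : IsUnif ϖ) (k : ℕ) (f : TateInt L n)
    (hf : ∀ t, ‖tcoeff t (f : TateAlg L n)‖ ≤ ‖(ϖ : L)‖ ^ k) : ∃ g, f = ϖ ^ k • g := by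
  have hc (t) : tcoeff t (TateAlg.const L n ((ϖ : L) ^ k)⁻¹ * (f : TateAlg L n)) =
      ((ϖ : L) ^ k)⁻¹ * tcoeff t (f : TateAlg L n) := tcoeff_const_mul _ _ _
  refine ⟨⟨TateAlg.const L n ((ϖ : L) ^ k)⁻¹ * f, mem_tateInt.2 fun t => ?_⟩, ?_⟩
  · rw [hc, norm_mul, norm_inv, norm_pow, inv_mul_le_one₀ (pow_pos h.norm_pos k)]
    exact hf t
  · ext1
    rw [tateInt_smul]
    ext1
    ext t
    change tcoeff t (f : TateAlg L n) = tcoeff t (_ * (_ * _))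
    rw [tcoeff_const_mul, hc, ← mul_assoc]
    simp [mul_inv_cancel₀ (pow_ne_zero k h.ne_zero)]

theorem norm_tcoeff_pow_smul {n : ℕ} (ϖ : IntRing L) (k : ℕ) (g : TateInt L n) (t : Fin n →₀ ℕ) :
    ‖tcoeff t ((ϖ ^ k • g : TateInt L n) : TateAlg L n)‖ ≤ ‖(ϖ : L)‖ ^ k := by
  rw [tateInt_smul, tcoeff_const_mul, norm_mul]
  have := mem_tateInt.1 g.2 t
  simpa using mul_le_of_le_one_right (by positivity) this

theorem mem_span_pow_smul_top {O M : Type*} [CommRing O] [AddCommGroup M] [Module O M] (a : O)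
    (k : ℕ) (x : M) :
    x ∈ (Ideal.span {a} ^ k • ⊤ : Submodule O M) ↔ ∃ y, x = a ^ k • y := by
  rw [Ideal.span_singleton_pow, Submodule.ideal_span_singleton_smul,
    Submodule.mem_smul_pointwise_iff_exists]
  simp [eq_comm]

/-- Limits are taken coefficientwise. The convergence is uniform in the coefficients, so the limit
is again restricted. -/
theorem isPrecomplete_tateInt [CompleteSpace L] {ϖ : IntRing L} (h : IsUnif ϖ) (n : ℕ) :
    IsPrecomplete (Ideal.span {ϖ}) (TateInt L n) where
  prec' f hf := by
    have hsub (t) (f g : TateInt L n) : tcoeff t ((f - g : TateInt L n) : TateAlg L n) =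
        tcoeff t (f : TateAlg L n) - tcoeff t (g : TateAlg L n) :=
      map_sub (MvPowerSeries.coeff t) (f : TateAlg L n).1 (g : TateAlg L n).1
    have hf' {m k : ℕ} (hmk : m ≤ k) (t) :
        ‖tcoeff t (f m : TateAlg L n) - tcoeff t (f k : TateAlg L n)‖ ≤ ‖(ϖ : L)‖ ^ m := by
      obtain ⟨y, hy⟩ := (mem_span_pow_smul_top _ _ _).1 (SModEq.sub_mem.1 (hf hmk))
      rw [← hsub, hy]
      exact norm_tcoeff_pow_smul ϖ m y t
    have hc (t) : CauchySeq fun k => tcoeff t (f k : TateAlg L n) := by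
      refine cauchySeq_of_le_tendsto_0' (fun n => ‖(ϖ : L)‖ ^ n) (fun m k hmk => ?_) h.tendsto
      rw [dist_eq_norm]
      exact hf' hmk t
    choose l hl using fun t => cauchySeq_tendsto_of_complete (hc t)
    have hln (k : ℕ) (t) : ‖tcoeff t (f k : TateAlg L n) - l t‖ ≤ ‖(ϖ : L)‖ ^ k :=
      le_of_tendsto ((tendsto_const_nhds.sub (hl t)).norm)
        (Filter.eventually_atTop.2 ⟨k, fun j hj => hf' hj t⟩)
    have hmem : (l : MvPowerSeries (Fin n) L) ∈ TateAlg L n := by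
      refine mem_tateAlg.2 fun ε hε => ?_
      obtain ⟨k, hk⟩ := h.exists_pow_lt hε
      refine (mem_tateAlg.1 (f k : TateAlg L n).2 ε hε).subset fun t ht => ?_
      change ε ≤ ‖l t‖ at ht
      change ε ≤ ‖tcoeff t (f k : TateAlg L n)‖
      by_contra! hlt
      have h1 : ‖l t‖ ≤ max ‖tcoeff t (f k : TateAlg L n)‖ ‖tcoeff t (f k : TateAlg L n) - l t‖ := by
        have := IsUltrametricDist.norm_add_le_max (tcoeff t (f k : TateAlg L n))
          (l t - tcoeff t (f k : TateAlg L n))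
        rwa [add_sub_cancel, norm_sub_rev (l t)] at this
      exact absurd ht (not_le.2 (h1.trans_lt (max_lt hlt ((hln k t).trans_lt hk))))
    let g : TateInt L n := ⟨⟨l, hmem⟩, mem_tateInt.2 fun t =>
      le_of_tendsto (hl t).norm (Filter.Eventually.of_forall fun k => mem_tateInt.1 (f k).2 t)⟩
    refine ⟨g, fun k => ?_⟩
    rw [SModEq.sub_mem, mem_span_pow_smul_top]
    refine exists_eq_pow_smul h k _ fun t => ?_
    rw [hsub]
    exact hln k t

variable (L) in
/-- Polynomials as elements of the Tate algebra. -/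
def polyToTateInt (n : ℕ) : MvPolynomial (Fin n) (IntRing L) →+* TateInt L n :=
  RingHom.codRestrict (RingHom.codRestrict
    ((MvPowerSeries.map (IntRing L).subtype).comp MvPolynomial.coeToMvPowerSeries.ringHom)
    (TateAlg L n) fun p => mem_tateAlg.2 fun ε hε => by
      refine p.support.finite_toSet.subset fun t ht => ?_
      rw [Finset.mem_coe, MvPolynomial.mem_support_iff]
      intro h0
      have h1 : MvPowerSeries.coeff t (MvPolynomial.toMvPowerSeries p) = 0 := by
        rw [MvPolynomial.coeff_coe, h0]
      simp only [Set.mem_ofPred_eq, RingHom.comp_apply, MvPolynomial.coeToMvPowerSeries.ringHom_apply,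
        MvPowerSeries.coeff_map, h1, map_zero, norm_zero] at ht
      linarith)
    (TateInt L n) fun p => ⟨_, rfl⟩

theorem tcoeff_polyToTateInt {n : ℕ} (p : MvPolynomial (Fin n) (IntRing L)) (t : Fin n →₀ ℕ) :
    tcoeff t (polyToTateInt L n p : TateAlg L n) = MvPolynomial.coeff t p := by
  change MvPowerSeries.coeff t (MvPowerSeries.map (IntRing L).subtype
    (MvPolynomial.toMvPowerSeries p)) = _
  rw [MvPowerSeries.coeff_map, MvPolynomial.coeff_coe]
  rfl

theorem polyToTateInt_C {n : ℕ} (a : IntRing L) :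
    polyToTateInt L n (MvPolynomial.C a) = algebraMap (IntRing L) (TateInt L n) a := by
  ext1; ext1
  change MvPowerSeries.map (IntRing L).subtype (MvPolynomial.toMvPowerSeries (MvPolynomial.C a)) =
    MvPowerSeries.C (a : L)
  rw [MvPolynomial.coe_C, MvPowerSeries.map_C]
  rfl

/-- All but finitely many coefficients have absolute value less than `1`, hence are divisible by
`ϖ`. This makes polynomials surjective modulo `ϖ`. -/
theorem exists_eq_poly_add {n : ℕ} {ϖ : IntRing L} (h : IsUnif ϖ) (f : TateInt L n) :
    ∃ p g, f = polyToTateInt L n p + ϖ • g := by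
  classical
  have hfin := mem_tateAlg.1 (f : TateAlg L n).2 1 one_pos
  let p : MvPolynomial (Fin n) (IntRing L) := ∑ t ∈ hfin.toFinset,
    MvPolynomial.monomial t ⟨tcoeff t (f : TateAlg L n), mem_intRing.2 (mem_tateInt.1 f.2 t)⟩
  obtain ⟨g, hg⟩ := exists_eq_pow_smul h 1 (f - polyToTateInt L n p) (fun t => by
    have hsub : tcoeff t ((f - polyToTateInt L n p : TateInt L n) : TateAlg L n) =
        tcoeff t (f : TateAlg L n) - MvPolynomial.coeff t p := by
      rw [← tcoeff_polyToTateInt]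
      exact map_sub (MvPowerSeries.coeff t) (f : TateAlg L n).1 (polyToTateInt L n p : TateAlg L n).1
    rw [hsub, MvPolynomial.coeff_sum]
    simp only [MvPolynomial.coeff_monomial, Finset.sum_ite_eq', Set.Finite.mem_toFinset,
      Set.mem_ofPred_eq, pow_one]
    split_ifs with ht
    · simp
    · simpa using h.norm_le _ (not_le.1 ht))
  exact ⟨p, g, by rw [← pow_one ϖ, ← hg]; ring⟩

theorem exists_pow_mul_mem_tateInt {n : ℕ} {ϖ : IntRing L} (h : IsUnif ϖ) (f : TateAlg L n) :
    ∃ k : ℕ, TateAlg.const L n ((ϖ : L) ^ k) * f ∈ TateInt L n := by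
  have hfin := mem_tateAlg.1 f.2 1 one_pos
  choose N hN using fun t => h.exists_norm_pow_mul_le (tcoeff t f)
  refine ⟨hfin.toFinset.sup N, mem_tateInt.2 fun t => ?_⟩
  rw [tcoeff_const_mul]
  by_cases ht : t ∈ hfin.toFinset
  · obtain ⟨j, hj⟩ := Nat.exists_eq_add_of_le (Finset.le_sup (f := N) ht)
    rw [hj, pow_add, mul_comm (_ ^ _), mul_assoc, norm_mul, norm_pow]
    exact mul_le_one₀ (pow_le_one₀ (norm_nonneg _) h.norm_lt_one.le) (norm_nonneg _) (hN t)
  · rw [norm_mul, norm_pow]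
    have : ‖tcoeff t f‖ < 1 := by simpa using ht
    exact mul_le_one₀ (pow_le_one₀ (norm_nonneg _) h.norm_lt_one.le) (norm_nonneg _) this.le

end Affinoid

/-! ### Integral models of affinoid algebras -/

section AffinoidModel

variable {L : Type u} [NormedField L] [IsUltrametricDist L]

omit [IsUltrametricDist L] in
theorem norm_algebraMap_mul {C : Type*} [NormedCommRing C] [NormedAlgebra L C] (a : L) (c : C) :
    ‖algebraMap L C a * c‖ = ‖a‖ * ‖c‖ := by
  rw [← Algebra.smul_def, norm_smul]

/-- An integral model of an affinoid algebra. -/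
theorem AffinoidAlg.exists_integral_model [CompleteSpace L] {ϖ : IntRing L} (h : IsUnif ϖ)
    (C : AffinoidAlg L) :
    ∃ (R : Type u) (_ : CommRing R) (_ : Algebra (IntRing L) R) (_ : Algebra R C),
      IsNoetherianRing R ∧
      Algebra.FiniteType (IntRing L) (R ⧸ Ideal.span {algebraMap (IntRing L) R ϖ}) ∧
      algebraMap (IntRing L) R ϖ ∈ Ideal.jacobson (⊥ : Ideal R) ∧
      Function.Injective (algebraMap R C) ∧
      (∀ r : IntRing L, algebraMap R C (algebraMap (IntRing L) R r) = algebraMap L C r) ∧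
      (∀ c : C, ∃ (r : R) (k : ℕ), algebraMap R C r = c * algebraMap L C ϖ ^ k) ∧
      ∃ K : ℝ, ∀ r : R, ‖algebraMap R C r‖ ≤ K := by
  obtain ⟨n, pr, hsurj, hconst, K, hK⟩ := C.exists_presentation
  -- The model is the image of the power series with integral coefficients; precompleteness passes
  -- to this quotient.
  let F : TateInt L n →+* C := pr.comp (TateInt L n).subtype
  let R := F.range
  let F' : TateInt L n →+* R := F.rangeRestrict
  have hF' : Function.Surjective F' := F.rangeRestrict_surjective
  let _ : Algebra (IntRing L) R := (F'.comp (algebraMap (IntRing L) (TateInt L n))).toAlgebra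
  let _ : Algebra R C := R.subtype.toAlgebra
  have hOC (r : IntRing L) : algebraMap R C (algebraMap (IntRing L) R r) = algebraMap L C r :=
    hconst r
  have hbdd (r : R) : ‖algebraMap R C r‖ ≤ K := by
    obtain ⟨f, rfl⟩ := hF' r
    exact (hK f.1 1 (mem_tateInt.1 f.2)).trans_eq (mul_one K)
  let a := algebraMap (IntRing L) R ϖ
  have hmapspan : (Ideal.span {ϖ}).map (algebraMap (IntRing L) R) = Ideal.span {a} := by
    rw [Ideal.map_span, Set.image_singleton]
  let Fl : TateInt L n →ₐ[IntRing L] R := { F' with commutes' := fun _ => rfl }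
  have hpre : IsPrecomplete (Ideal.span {ϖ}) R := by
    have := isPrecomplete_tateInt h n
    refine AdicCompletion.of_surjective_iff.1 ?_
    have h1 := AdicCompletion.map_surjective (Ideal.span {ϖ}) (f := Fl.toLinearMap) hF'
    have h2 := AdicCompletion.of_surjective (Ideal.span {ϖ}) (TateInt L n)
    intro y
    obtain ⟨x, rfl⟩ := (h1.comp h2) y
    exact ⟨Fl x, (AdicCompletion.map_of (Ideal.span {ϖ}) Fl.toLinearMap x).symm⟩
  -- Elements of `ϖ^k R` have norm at most `|ϖ|^k K`, since `R` is bounded.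
  have hhaus : IsHausdorff (Ideal.span {ϖ}) R := ⟨fun x hx => by
    apply Subtype.ext
    change algebraMap R C x = 0
    rw [← norm_eq_zero]
    refine le_antisymm (ge_of_tendsto' (by simpa using h.tendsto.mul_const K) fun k => ?_)
      (norm_nonneg _)
    obtain ⟨y, hy⟩ := (mem_span_pow_smul_top _ _ _).1 (SModEq.sub_mem.1 (hx k))
    rw [sub_zero] at hy
    rw [hy, Algebra.smul_def, map_mul, hOC, norm_algebraMap_mul]
    have : ‖((ϖ ^ k : IntRing L) : L)‖ = ‖(ϖ : L)‖ ^ k := by simp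
    rw [this]
    exact mul_le_mul_of_nonneg_left (hbdd y) (by positivity)⟩
  have hcomp : IsAdicComplete (Ideal.span {a}) R := by
    have : IsAdicComplete (Ideal.span {ϖ}) R := {}
    rw [← hmapspan]
    exact (IsAdicComplete.map_algebraMap_iff _ _).2 this
  have hpoly : Function.Surjective ((Ideal.Quotient.mk (Ideal.span {a})).comp
      (F'.comp (polyToTateInt L n))) := by
    intro y
    obtain ⟨y, rfl⟩ := Ideal.Quotient.mk_surjective y
    obtain ⟨f, rfl⟩ := hF' y
    obtain ⟨p, g, rfl⟩ := exists_eq_poly_add h f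
    refine ⟨p, ?_⟩
    rw [RingHom.comp_apply, RingHom.comp_apply, Ideal.Quotient.mk_eq_mk_iff_sub_mem, map_add,
      sub_add_cancel_left, neg_mem_iff]
    refine Ideal.mem_span_singleton'.2 ⟨F' g, ?_⟩
    rw [Algebra.smul_def, map_mul, mul_comm]
    rfl
  have := h.isNoetherianRing
  refine ⟨R, inferInstance, inferInstance, inferInstance, ?_, ?_, ?_, Subtype.val_injective, hOC, ?_,
    K, hbdd⟩
  · exact isNoetherianRing_of_isAdicComplete _ (Ideal.span {a}) ⟨{a}, by simp⟩ hpoly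
  · let Q : MvPolynomial (Fin n) (IntRing L) →ₐ[IntRing L] R ⧸ Ideal.span {a} :=
      { (Ideal.Quotient.mk (Ideal.span {a})).comp (F'.comp (polyToTateInt L n)) with
        commutes' := fun r => by
          change (Ideal.Quotient.mk (Ideal.span {a})) (F' (polyToTateInt L n (MvPolynomial.C r))) = _
          rw [polyToTateInt_C]
          rfl }
    exact Algebra.FiniteType.of_surjective Q hpoly
  · exact IsAdicComplete.le_jacobson_bot (Ideal.span {a}) (Ideal.mem_span_singleton_self a)
  · intro c
    obtain ⟨f, rfl⟩ := hsurj c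
    obtain ⟨k, hk⟩ := exists_pow_mul_mem_tateInt h f
    refine ⟨F' ⟨_, hk⟩, k, ?_⟩
    change pr (_ * f) = _
    rw [map_mul, hconst, map_pow, mul_comm]

/-- The kernel is a maximal ideal of a Banach algebra, hence closed, and linear maps from the
finite-dimensional quotient are continuous. -/
theorem continuous_of_finiteDimensional_codomain {L : Type*} [NontriviallyNormedField L]
    [CompleteSpace L]
    {C : Type*} [NormedCommRing C] [NormedAlgebra L C] [CompleteSpace C] {E : Type*} [NormedField E]
    [NormedAlgebra L E] [FiniteDimensional L E] (ψ : C →ₐ[L] E) : Continuous ψ := by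
  have h1 : IsField ψ.range := by
    have : Module.Finite L ψ.range := inferInstance
    exact Algebra.IsIntegral.isField_iff_isField (R := L)
      (FaithfulSMul.algebraMap_injective L ψ.range) |>.1 (Field.toIsField L)
  have hK : (RingHom.ker ψ.rangeRestrict).IsMaximal :=
    Ideal.Quotient.maximal_of_isField _
      ((Ideal.quotientKerAlgEquivOfSurjective ψ.rangeRestrict_surjective).toMulEquiv.isField h1)
  have hcl : IsClosed ((RingHom.ker ψ.rangeRestrict : Ideal C) : Set C) := hK.isClosed
  have hcl' : IsClosed ((ψ.toLinearMap.ker : Submodule L C) : Set C) := by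
    convert hcl using 1
    ext x
    simp [RingHom.mem_ker, Subtype.ext_iff]
  let f : C ⧸ ψ.toLinearMap.ker →ₗ[L] E := ψ.toLinearMap.ker.liftQ ψ.toLinearMap le_rfl
  have hfin : FiniteDimensional L (C ⧸ ψ.toLinearMap.ker) :=
    ψ.toLinearMap.quotKerEquivRange.symm.finiteDimensional
  have hf : Continuous f := f.continuous_of_finiteDimensional
  exact hf.comp continuous_quotient_mk'

end AffinoidModel

/-! ### Power-boundedness from absolute values at points -/

section SpectralRadius

variable {L : Type u} [NormedField L] [IsUltrametricDist L]

/-- The normed field structure on a field with a uniformizer is nontrivial. -/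
abbrev IsUnif.nontriviallyNormedField {ϖ : IntRing L} (h : IsUnif ϖ) : NontriviallyNormedField L where
  __ := ‹NormedField L›
  non_trivial := ⟨(ϖ : L)⁻¹, by
    rw [norm_inv]
    exact (one_lt_inv₀ h.norm_pos).2 h.norm_lt_one⟩

/-- A point of an integral model extends to a point of the affinoid algebra. -/
theorem exists_point_of_integral_model [CompleteSpace L] {ϖ : IntRing L} (h : IsUnif ϖ)
    (C : AffinoidAlg L) {R : Type u} [CommRing R] [Algebra (IntRing L) R] [Algebra R C]
    (hinj : Function.Injective (algebraMap R C))
    (hOC : ∀ r : IntRing L, algebraMap R C (algebraMap (IntRing L) R r) = algebraMap L C r)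
    (hloc : ∀ c : C, ∃ (r : R) (k : ℕ), algebraMap R C r = c * algebraMap L C ϖ ^ k)
    {D : Type u} [CommRing D] [IsDomain D] [Algebra (IntRing L) D] [Module.Finite (IntRing L) D]
    (h0 : algebraMap (IntRing L) D ϖ ≠ 0) (φ : R →ₐ[IntRing L] D) :
    ∃ (E : Type u) (_ : NormedField E) (_ : IsUltrametricDist E) (_ : NormedAlgebra L E)
      (_ : FiniteDimensional L E) (ψ : C →A[L] E) (θ : D →+* E),
      (∀ r, ψ (algebraMap R C r) = θ (φ r)) ∧
      (∀ r, θ (algebraMap (IntRing L) D r) = algebraMap L E r) ∧ ∀ d, ‖θ d‖ ≤ 1 := by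
  let _ : NontriviallyNormedField L := h.nontriviallyNormedField
  obtain ⟨E, i1, i2, i3, i4, θ, hθ, hθ1⟩ := exists_normedField L D h.exists_norm_pow_mul_le h0
  let a := algebraMap (IntRing L) R ϖ
  have haC : algebraMap R C a = algebraMap L C ϖ := hOC ϖ
  have haE : θ (φ a) = algebraMap L E ϖ := by rw [AlgHom.commutes, hθ]
  -- `C` is `R[1/ϖ]`, so a point of `R` at which `ϖ` does not vanish extends to it.
  have : IsLocalization.Away a C :=
    { map_units := by
        rintro ⟨_, k, rfl⟩
        change IsUnit (algebraMap R C (a ^ k))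
        rw [map_pow, haC, ← map_pow]
        exact (IsUnit.mk0 _ (pow_ne_zero k h.ne_zero)).map _
      surj := fun c => by
        obtain ⟨r, k, hrk⟩ := hloc c
        refine ⟨⟨r, ⟨a ^ k, k, rfl⟩⟩, ?_⟩
        change c * algebraMap R C (a ^ k) = algebraMap R C r
        rw [map_pow, haC, hrk]
      exists_of_eq := fun {x y} hxy => ⟨1, by rw [hinj hxy]⟩ }
  have hu : IsUnit ((θ.comp (φ : R →+* D)) a) := by
    change IsUnit (θ (φ a))
    rw [haE]
    exact (IsUnit.mk0 _ h.ne_zero).map _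
  let ψ0 : C →+* E := IsLocalization.Away.lift a hu
  have hψ0 (r : R) : ψ0 (algebraMap R C r) = θ (φ r) := IsLocalization.Away.lift_eq a hu r
  have hψO (r : IntRing L) : ψ0 (algebraMap L C r) = algebraMap L E r := by
    rw [← hOC, hψ0, AlgHom.commutes, hθ]
  have hψL (l : L) : ψ0 (algebraMap L C l) = algebraMap L E l := by
    obtain ⟨N, hN⟩ := h.exists_norm_pow_mul_le l
    have h1 := hψO ⟨_, mem_intRing.2 hN⟩
    have h2 := hψO (ϖ ^ N)
    have h3 : ((ϖ ^ N : IntRing L) : L) = (ϖ : L) ^ N := by simp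
    rw [h3] at h2
    simp only [map_mul] at h1
    rw [h2] at h1
    refine mul_left_cancel₀ ?_ h1
    exact (map_ne_zero_iff _ (algebraMap L E).injective).2 (pow_ne_zero N h.ne_zero)
  let ψ1 : C →ₐ[L] E := { ψ0 with commutes' := hψL }
  exact ⟨E, i1, i2, i3, i4, ⟨ψ1, continuous_of_finiteDimensional_codomain ψ1⟩, θ, hψ0, hθ, hθ1⟩

/-- Division by a monic equation shows that finitely many powers of `g` span `R[g]` over the bounded
ring `R`. -/
theorem exists_bound_aeval {C : Type*} [NormedCommRing C] {R : Type*} [CommRing R] [Algebra R C]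
    {K : ℝ} (hK : ∀ r : R, ‖algebraMap R C r‖ ≤ K) {g : C} (hg : IsIntegral R g) :
    ∃ K' : ℝ, ∀ p : Polynomial R, ‖Polynomial.aeval g p‖ ≤ K' := by
  obtain ⟨q, hq, hqg⟩ := hg
  have hqg' : Polynomial.aeval g q = 0 := hqg
  refine ⟨∑ i ∈ Finset.range (q.natDegree + 1), K * ‖g ^ i‖, fun p => ?_⟩
  have h1 : Polynomial.aeval g p = Polynomial.aeval g (p %ₘ q) := by
    conv_lhs => rw [← Polynomial.modByMonic_add_div p q]
    rw [map_add, map_mul, hqg', zero_mul, add_zero]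
  rw [h1, Polynomial.aeval_eq_sum_range' (n := q.natDegree + 1)
    (Nat.lt_succ_of_le (Polynomial.natDegree_modByMonic_le p hq))]
  refine (norm_sum_le _ _).trans (Finset.sum_le_sum fun i _ => ?_)
  rw [Algebra.smul_def]
  exact (norm_mul_le _ _).trans (mul_le_mul_of_nonneg_right (hK _) (norm_nonneg _))

/-- A function on an affinoid space of absolute value at most `1` at all points is power-bounded,
and it is topologically nilpotent if it is of absolute value less than `1` at all points. -/
theorem AffinoidAlg.exists_bound_pow [CompleteSpace L] {ϖ : IntRing L} (h : IsUnif ϖ)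
    (C : AffinoidAlg L) (g : C)
    (hg : ∀ (E : Type u) [NormedField E] [IsUltrametricDist E] [NormedAlgebra L E]
      [FiniteDimensional L E] (ψ : C →A[L] E), ‖ψ g‖ ≤ 1) :
    (∃ K : ℝ, ∀ n : ℕ, ‖g ^ n‖ ≤ K) ∧
    ((∀ (E : Type u) [NormedField E] [IsUltrametricDist E] [NormedAlgebra L E]
      [FiniteDimensional L E] (ψ : C →A[L] E), ‖ψ g‖ < 1) → ∀ ε > 0, ∃ n : ℕ, ‖g ^ n‖ ≤ ε) := by
  obtain ⟨R, i1, i2, i3, hnoeth, hft, hjac, hinj, hOC, hloc, K, hK⟩ := C.exists_integral_model h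
  have := h.isPrecomplete
  have hunit : IsUnit (algebraMap R C (algebraMap (IntRing L) R ϖ)) := by
    rw [hOC]
    exact (IsUnit.mk0 _ h.ne_zero).map _
  -- A point at which `1/g` has the value `t` becomes a point of `C` at which `g` has the value
  -- `1/t`.
  have key {D : Type u} [CommRing D] [IsDomain D] [Algebra (IntRing L) D]
      [Module.Finite (IntRing L) D] (h0 : algebraMap (IntRing L) D ϖ ≠ 0) (φ : R →ₐ[IntRing L] D)
      (t : D) (ht : ∀ (r : R) (k : ℕ),
        algebraMap R C r = g * algebraMap R C (algebraMap (IntRing L) R ϖ) ^ k →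
        φ r * t = algebraMap (IntRing L) D ϖ ^ k) :
      ∃ (E : Type u) (_ : NormedField E) (_ : IsUltrametricDist E) (_ : NormedAlgebra L E)
        (_ : FiniteDimensional L E) (ψ : C →A[L] E) (θ : D →+* E), ψ g * θ t = 1 ∧
        (∀ r, θ (algebraMap (IntRing L) D r) = algebraMap L E r) ∧ ∀ d, ‖θ d‖ ≤ 1 := by
    obtain ⟨E, j1, j2, j3, j4, ψ, θ, hψ, hθ, hθ1⟩ :=
      exists_point_of_integral_model h C hinj hOC hloc h0 φ
    refine ⟨E, j1, j2, j3, j4, ψ, θ, ?_, hθ, hθ1⟩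
    obtain ⟨r, k, hrk⟩ := hloc g
    have h1 := congrArg θ (ht r k (by rw [hrk, hOC]))
    rw [map_mul, ← hψ, hrk, map_pow, hθ, map_mul, map_pow, AlgHomClass.commutes] at h1
    have h2 : (algebraMap L E ϖ) ^ k ≠ 0 := pow_ne_zero k (by simpa using h.ne_zero)
    refine mul_left_cancel₀ h2 ?_
    linear_combination h1
  have hint : IsIntegral R g := by
    rcases isIntegral_or_exists_point h.isMaximal hunit hjac g with hg1 |
      ⟨D, j1, j2, j3, φ, t, hfin, h0, ht, N, c, hN⟩
    · exact hg1
    · exfalso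
      obtain ⟨E, k1, k2, k3, k4, ψ, θ, hψ, hθ, hθ1⟩ := key h0 φ t ht
      have h1 : ‖θ t‖ ^ N < 1 := by
        rw [← norm_pow, ← map_pow, hN, map_mul, hθ, norm_mul, norm_algebraMap']
        exact (mul_le_of_le_one_right (norm_nonneg _) (hθ1 c)).trans_lt h.norm_lt_one
      have h2 : ‖θ t‖ < 1 := by
        by_contra! hcon
        exact absurd h1 (not_lt.2 (one_le_pow₀ hcon))
      have h3 : ‖ψ g‖ * ‖θ t‖ = 1 := by rw [← norm_mul, hψ, norm_one]
      have h4 := mul_le_of_le_one_left (norm_nonneg (θ t)) (hg E ψ)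
      linarith
  obtain ⟨K', hK'⟩ := exists_bound_aeval hK hint
  refine ⟨⟨K', fun n => ?_⟩, fun hg' ε hε => ?_⟩
  · simpa using hK' (Polynomial.X ^ n)
  -- If `g^N = ϖ p(g)`, then `g^{Nk} = ϖ^k p(g)^k`, and `p(g)^k` stays in the bounded set `R[g]`.
  · rcases pow_eq_mul_or_exists_point h.isMaximal hunit g with ⟨N, p, hp⟩ |
      ⟨D, j1, j2, j3, φ, t, hfin, h0, ht⟩
    · obtain ⟨k, hk⟩ := h.exists_pow_lt (ε := ε / (|K'| + 1)) (by positivity)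
      refine ⟨N * k, ?_⟩
      rw [pow_mul, hp, hOC, mul_pow, ← map_pow, norm_algebraMap_mul, norm_pow, ← map_pow]
      calc ‖(ϖ : L)‖ ^ k * ‖Polynomial.aeval g (p ^ k)‖
          ≤ (ε / (|K'| + 1)) * (|K'| + 1) := by
            refine mul_le_mul hk.le ?_ (norm_nonneg _) (by positivity)
            linarith [hK' (p ^ k), le_abs_self K']
        _ = ε := div_mul_cancel₀ _ (by positivity)
    · exfalso
      obtain ⟨E, k1, k2, k3, k4, ψ, θ, hψ, hθ, hθ1⟩ := key h0 φ t ht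
      have h3 : ‖ψ g‖ * ‖θ t‖ = 1 := by rw [← norm_mul, hψ, norm_one]
      have h4 := mul_le_of_le_one_right (norm_nonneg (ψ g)) (hθ1 t)
      linarith [hg' E ψ]

end SpectralRadius

/-! ### Adic rings -/

section Adic

theorem _root_.IsAdic.isTopologicalRing {B : Type*} [CommRing B] [TopologicalSpace B] {J : Ideal B}
    (hJ : IsAdic J) : IsTopologicalRing B := by
  have h : ‹TopologicalSpace B› = J.adicTopology := hJ
  subst h
  have := J.nonarchimedean
  infer_instance

theorem _root_.IsAdic.hasBasis {B : Type*} [CommRing B] [TopologicalSpace B] {J : Ideal B}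
    (hJ : IsAdic J) : (nhds (0 : B)).HasBasis (fun _ : ℕ => True) fun n => ((J ^ n : Ideal B) : Set B) := by
  have h : ‹TopologicalSpace B› = J.adicTopology := hJ
  subst h
  exact J.hasBasis_nhds_zero_adic

theorem _root_.IsAdic.hasBasis_nhds' {B : Type*} [CommRing B] [TopologicalSpace B] {J : Ideal B}
    (hJ : IsAdic J) (x : B) :
    (nhds x).HasBasis (fun _ : ℕ => True) fun n => (fun y => x + y) '' ((J ^ n : Ideal B) : Set B) := by
  have h : ‹TopologicalSpace B› = J.adicTopology := hJ
  subst h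
  exact J.hasBasis_nhds_adic x

theorem continuous_of_le_comap {A B : Type*} [CommRing A] [CommRing B] [TopologicalSpace A]
    [TopologicalSpace B] {I : Ideal A} {J : Ideal B} (hI : IsAdic I) (hJ : IsAdic J) (i : A →+* B)
    (h : I.map i ≤ J) : Continuous i := by
  have := hI.isTopologicalRing
  have := hJ.isTopologicalRing
  refine continuous_of_continuousAt_zero i ?_
  rw [ContinuousAt, map_zero, hJ.hasBasis.tendsto_right_iff]
  intro n _
  filter_upwards [hI.hasBasis.mem_of_mem (i := n) trivial] with a ha
  have : i a ∈ (I ^ n).map i := Ideal.mem_map_of_mem i ha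
  rw [Ideal.map_pow] at this
  exact Ideal.pow_right_mono h n this

theorem denseRange_of_isAdic {P B : Type*} [CommRing P] [CommRing B] [TopologicalSpace B]
    {J : Ideal B} (hJ : IsAdic J) (i : P →+* B) (hd : ∀ b k, ∃ a, i a - b ∈ J ^ k) :
    DenseRange i := by
  intro b
  refine (mem_closure_iff_nhds_basis (hJ.hasBasis_nhds' b)).2 fun k _ => ?_
  obtain ⟨a, ha⟩ := hd b k
  exact ⟨i a, ⟨a, rfl⟩, _, ha, add_sub_cancel _ _⟩

/-- Extension of ring homomorphisms to an adic completion. -/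
theorem exists_extension_of_isAdic {P B C : Type*} [CommRing P] [CommRing B] [TopologicalSpace B]
    [NormedCommRing C] [CompleteSpace C] {K : Ideal P} {J : Ideal B} (hJ : IsAdic J) (i : P →+* B)
    (hi : ∀ k, (J ^ k).comap i = K ^ k) (hd : ∀ b k, ∃ a, i a - b ∈ J ^ k) (f : P →+* C)
    (hf : ∀ ε > 0, ∃ k : ℕ, ∀ a ∈ K ^ k, ‖f a‖ < ε) :
    ∃ F : B →+* C, Continuous F ∧ ∀ a, F (i a) = f a := by
  let _ : TopologicalSpace P := K.adicTopology
  have hK : IsAdic K := rfl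
  have := hK.isTopologicalRing
  have := hJ.isTopologicalRing
  let _ : UniformSpace P := IsTopologicalAddGroup.rightUniformSpace P
  let _ : UniformSpace B := IsTopologicalAddGroup.rightUniformSpace B
  have : IsUniformAddGroup P := isUniformAddGroup_of_addCommGroup
  have : IsUniformAddGroup B := isUniformAddGroup_of_addCommGroup
  -- By `hi` the `K`-adic topology is induced from `B`, so `f` extends from a dense subring by
  -- uniform continuity.
  have hind : Topology.IsInducing i := by
    refine (IsTopologicalAddGroup.isInducing_iff_nhds_zero (f := i)).2 ?_
    refine hK.hasBasis.eq_of_same_basis ?_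
    convert hJ.hasBasis.comap i using 2 with k
    rw [← hi]
    rfl
  have hui : IsUniformInducing i := AddMonoidHom.isUniformInducing_of_isInducing hind
  have hdr := denseRange_of_isAdic hJ i hd
  have hfc : UniformContinuous f := by
    refine uniformContinuous_of_continuousAt_zero f ?_
    rw [ContinuousAt, map_zero, Metric.nhds_basis_ball.tendsto_right_iff]
    intro ε hε
    obtain ⟨k, hk⟩ := hf ε hε
    filter_upwards [hK.hasBasis.mem_of_mem (i := k) trivial] with a ha
    simpa using hk a ha
  refine ⟨IsDenseInducing.extendRingHom hui hdr hfc,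
    (uniformContinuous_uniformly_extend hui hdr hfc).continuous, fun a => ?_⟩
  exact IsDenseInducing.extend_eq (hui.isDenseInducing hdr) hfc.continuous a

/-- A ring homomorphism with bounded image that maps generators of an ideal to topologically
nilpotent elements is continuous for the adic topology. -/
theorem exists_pow_norm_lt {P C : Type*} [CommRing P] [NormedCommRing C] [IsUltrametricDist C]
    (f : P →+* C) {M : ℝ} (hM : ∀ a, ‖f a‖ ≤ M) {S : Set P} (hS : (Ideal.span S).FG)
    (hn : ∀ s ∈ S, ∀ ε > 0, ∃ n : ℕ, ‖f s ^ n‖ ≤ ε) :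
    ∀ ε > 0, ∃ k : ℕ, ∀ a ∈ Ideal.span S ^ k, ‖f a‖ < ε := by
  intro ε hε
  have hM0 : 0 ≤ M := (norm_nonneg _).trans (hM 0)
  -- The elements all of whose multiples have image of norm less than `ε`; they form an ideal by the
  -- ultrametric inequality, and it contains a power of each generator.
  let T : Ideal P :=
    { carrier := {a | ∀ b, ‖f (b * a)‖ < ε}
      add_mem' := fun {a a'} ha ha' b => by
        rw [mul_add, map_add]
        exact (IsUltrametricDist.norm_add_le_max _ _).trans_lt (max_lt (ha b) (ha' b))
      zero_mem' := fun b => by simpa using hε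
      smul_mem' := fun c a ha b => by
        rw [smul_eq_mul, ← mul_assoc]
        exact ha _ }
  have hT : Ideal.span S ≤ T.radical := by
    refine Ideal.span_le.2 fun s hs => ?_
    obtain ⟨n, hn⟩ := hn s hs (ε / (M + 1)) (by positivity)
    refine ⟨n, fun b => ?_⟩
    rw [map_mul, map_pow]
    calc ‖f b * f s ^ n‖ ≤ ‖f b‖ * ‖f s ^ n‖ := norm_mul_le _ _
      _ ≤ M * (ε / (M + 1)) := by gcongr; exact hM b
      _ < (M + 1) * (ε / (M + 1)) := by gcongr; linarith
      _ = ε := mul_div_cancel₀ _ (by positivity)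
  obtain ⟨k, hk⟩ := Ideal.exists_pow_le_of_le_radical_of_fg hT hS
  refine ⟨k, fun a ha => ?_⟩
  simpa using hk ha 1

end Adic

/-! ### Completions of noetherian algebras -/

section Completion

variable {L : Type u} [NormedField L] [IsUltrametricDist L]

theorem pow_map_eq_ker_evalₐ {P : Type*} [CommRing P] {K : Ideal P} (hK : K.FG) (k : ℕ) :
    K.map (algebraMap P (AdicCompletion K P)) ^ k = RingHom.ker (AdicCompletion.evalₐ K k) := by
  have h := AdicCompletion.pow_smul_top_eq_ker_eval (M := P) (n := k) hK
  rw [← Ideal.map_pow]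
  ext x
  have h1 := SetLike.ext_iff.1 h x
  have h2 : (x ∈ (K ^ k • ⊤ : Submodule P (AdicCompletion K P))) ↔
      x ∈ (K ^ k).map (algebraMap P (AdicCompletion K P)) := by
    rw [Ideal.smul_top_eq_map]
    rfl
  rw [← h2, h1, LinearMap.mem_ker, RingHom.mem_ker]
  constructor
  · intro h3
    rw [← AdicCompletion.factor_eval_eq_evalₐ K x (by simp), h3, map_zero]
  · intro h3
    rw [← AdicCompletion.factor_evalₐ_eq_eval K x (by simp), h3, map_zero]

/-- The completion of an algebra, as an adic algebra. -/
def completedAlg (P : Type u) [CommRing P] [Algebra (IntRing L) P] (hP : IsNoetherianRing P)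
    (K : Ideal P) (hK : (maximalIdeal (IntRing L)).map (algebraMap (IntRing L) P) ≤ K)
    (hft : Algebra.FiniteType (IntRing L) (P ⧸ K)) : FormalAlg L :=
  let J := K.map (algebraMap P (AdicCompletion K P))
  have hfg : K.FG := hP.noetherian K
  have hcomp : IsAdicComplete J (AdicCompletion K P) := by
    have := AdicCompletion.isAdicComplete (I := K) (M := P) hfg
    exact (IsAdicComplete.map_algebraMap_iff (I := K) (AdicCompletion K P)).2 this
  have hsurj : Function.Surjective
      ((Ideal.Quotient.mk J).comp (algebraMap P (AdicCompletion K P))) := by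
    intro b
    obtain ⟨b, rfl⟩ := Ideal.Quotient.mk_surjective b
    obtain ⟨a, ha⟩ := Ideal.Quotient.mk_surjective (AdicCompletion.evalOneₐ K b)
    refine ⟨a, Ideal.Quotient.eq.2 ?_⟩
    change _ ∈ K.map (algebraMap P (AdicCompletion K P))
    rw [← AdicCompletion.ker_evalOneₐ_eq_map K hfg, RingHom.mem_ker]
    change AdicCompletion.evalOneₐ K _ = 0
    rw [map_sub, ← ha]
    exact sub_self _
  { carrier := AdicCompletion K P
    topology := J.adicTopology
    noetherian := isNoetherianRing_of_isAdicComplete (algebraMap P (AdicCompletion K P)) J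
      (hfg.map _) hsurj
    exists_idealOfDefinition := by
      refine ⟨J, rfl, hcomp, ?_, ?_⟩
      · rw [IsScalarTower.algebraMap_eq (IntRing L) P (AdicCompletion K P), ← Ideal.map_map]
        exact Ideal.map_mono hK
      · let q : P ⧸ K →ₐ[IntRing L] AdicCompletion K P ⧸ J :=
          Ideal.quotientMapₐ J (IsScalarTower.toAlgHom (IntRing L) P (AdicCompletion K P))
            Ideal.le_comap_map
        refine hft.of_surjective q fun b => ?_
        obtain ⟨a, rfl⟩ := hsurj b
        exact ⟨Ideal.Quotient.mk K a, rfl⟩ }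

/-- `A` need not be of finite type over `O`, but `A → Q` factors through `A ⧸ I`, which is. -/
theorem finiteType_of_factors {O A Q : Type*} [CommRing O] [CommRing A] [CommRing Q] [Algebra O A]
    [Algebra O Q] [Algebra A Q] [IsScalarTower O A Q] {I : Ideal A}
    (hI : I ≤ RingHom.ker (algebraMap A Q)) [Algebra.FiniteType O (A ⧸ I)]
    [Algebra.FiniteType A Q] : Algebra.FiniteType O Q := by
  let g : A ⧸ I →+* Q := Ideal.Quotient.lift I (algebraMap A Q) hI
  have h1 : g.FiniteType := by
    refine RingHom.FiniteType.of_comp_finiteType (f := Ideal.Quotient.mk I) ?_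
    have : g.comp (Ideal.Quotient.mk I) = algebraMap A Q := by ext; rfl
    rw [this]
    exact RingHom.finiteType_algebraMap.2 ‹_›
  have h2 := h1.comp (RingHom.finiteType_algebraMap.2 ‹Algebra.FiniteType O (A ⧸ I)›)
  have h3 : g.comp (algebraMap O (A ⧸ I)) = algebraMap O Q := by
    ext r
    exact (IsScalarTower.algebraMap_apply O A Q r).symm
  rw [h3] at h2
  exact RingHom.finiteType_algebraMap.1 h2

end Completion

/-! ### Points of formal schemes -/

section Points

variable {L : Type u} [NormedField L] [IsUltrametricDist L] {A : FormalAlg L} {ϖ : IntRing L}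

/-- Some `I^k` maps into the unit ball, and `ϖ^k A ⊆ I^k`. -/
theorem ContHom.exists_norm_le (h : IsUnif ϖ) {C : Type u} [NormedCommRing C] [NormedAlgebra L C]
    (φ : ContHom A C) : ∃ M : ℝ, ∀ a, ‖φ.1 a‖ ≤ M := by
  obtain ⟨I, hI, -, hmax, -⟩ := A.exists_idealOfDefinition
  have h1 : φ.1 ⁻¹' Metric.ball 0 1 ∈ nhds (0 : A) :=
    φ.2.1.continuousAt.preimage_mem_nhds (by rw [map_zero]; exact Metric.ball_mem_nhds 0 one_pos)
  obtain ⟨k, -, hk⟩ := hI.hasBasis.mem_iff.1 h1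
  have hϖI : algebraMap (IntRing L) A ϖ ∈ I :=
    hmax (Ideal.mem_map_of_mem _ (mem_maximalIdeal_intRing.2 h.norm_lt_one))
  refine ⟨(‖(ϖ : L)‖ ^ k)⁻¹, fun a => ?_⟩
  have h2 := hk ((I ^ k).mul_mem_right a (Ideal.pow_mem_pow hϖI k))
  rw [Set.mem_preimage, mem_ball_zero_iff, map_mul, map_pow, φ.2.2, ← map_pow,
    norm_algebraMap_mul, norm_pow] at h2
  rw [← one_div, le_div_iff₀' (pow_pos h.norm_pos k)]
  exact h2.le

/-- The powers of `φ(a)` are bounded, and the norm of a field is multiplicative. -/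
theorem ContHom.norm_le_one (h : IsUnif ϖ) {E : Type u} [NormedField E] [NormedAlgebra L E]
    (φ : ContHom A E) (a : A) : ‖φ.1 a‖ ≤ 1 := by
  obtain ⟨M, hM⟩ := φ.exists_norm_le h
  by_contra! hcon
  obtain ⟨n, hn⟩ := pow_unbounded_of_one_lt M hcon
  have := hM (a ^ n)
  rw [map_pow, norm_pow] at this
  linarith

theorem ContHom.exists_norm_pow_le {C : Type u} [NormedCommRing C] [NormedAlgebra L C]
    (φ : ContHom A C) {I : Ideal A} (hI : IsAdic I) {a : A} (ha : a ∈ I) {ε : ℝ} (hε : 0 < ε) :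
    ∃ n : ℕ, ‖φ.1 a ^ n‖ ≤ ε := by
  have h1 : φ.1 ⁻¹' Metric.ball 0 ε ∈ nhds (0 : A) :=
    φ.2.1.continuousAt.preimage_mem_nhds (by rw [map_zero]; exact Metric.ball_mem_nhds 0 hε)
  obtain ⟨k, -, hk⟩ := hI.hasBasis.mem_iff.1 h1
  have h2 := hk (Ideal.pow_mem_pow ha k)
  rw [Set.mem_preimage, mem_ball_zero_iff, map_pow] at h2
  exact ⟨k, h2.le⟩

theorem ContHom.norm_lt_one {E : Type u} [NormedField E] [NormedAlgebra L E]
    (φ : ContHom A E) {I : Ideal A} (hI : IsAdic I) {a : A} (ha : a ∈ I) : ‖φ.1 a‖ < 1 := by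
  obtain ⟨n, hn⟩ := φ.exists_norm_pow_le hI ha (ε := 2⁻¹) (by norm_num)
  by_contra! hcon
  rw [norm_pow] at hn
  linarith [one_le_pow₀ hcon (n := n)]

theorem norm_mul_prod_pow_le {C ι : Type*} [NormedCommRing C] (g : ι → C) (M : ι → ℝ)
    (hg : ∀ i (n : ℕ), ‖g i ^ n‖ ≤ M i) (c : C) (s : Finset ι) (t : ι → ℕ) :
    ‖c * ∏ i ∈ s, g i ^ t i‖ ≤ ‖c‖ * ∏ i ∈ s, M i := by
  classical
  induction s using Finset.induction_on with
  | empty => simp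
  | insert j s hj ih =>
    rw [Finset.prod_insert hj, Finset.prod_insert hj, mul_left_comm, mul_left_comm ‖c‖]
    exact (norm_mul_le _ _).trans (mul_le_mul (hg j _) ih (norm_nonneg _)
      ((norm_nonneg _).trans (hg j 0)))

end Points

/-! ### Dilatations -/

section Dilatation

variable {L : Type u} [NormedField L] [IsUltrametricDist L]

/-- The algebra `A[f₁/c, …, f_r/c]`. -/
abbrev Dil {A : Type u} [CommRing A] {r : ℕ} (f : Fin r → A) (c : A) : Type u :=
  MvPolynomial (Fin r) A ⧸
    Ideal.span (Set.range fun i => MvPolynomial.C c * MvPolynomial.X i - MvPolynomial.C (f i))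

/-- The fractions that generate `A[f₁/c, …, f_r/c]`. -/
def Dil.X {A : Type u} [CommRing A] {r : ℕ} (f : Fin r → A) (c : A) (i : Fin r) : Dil f c :=
  Ideal.Quotient.mk _ (MvPolynomial.X i)

theorem Dil.mul_X {A : Type u} [CommRing A] {r : ℕ} (f : Fin r → A) (c : A) (i : Fin r) :
    algebraMap A (Dil f c) c * Dil.X f c i = algebraMap A (Dil f c) (f i) := by
  change Ideal.Quotient.mk _ (MvPolynomial.C c * MvPolynomial.X i) =
    Ideal.Quotient.mk _ (MvPolynomial.C (f i))
  exact Ideal.Quotient.eq.2 (Ideal.subset_span ⟨i, rfl⟩)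

theorem Dil.hom_ext {A : Type u} [CommRing A] {r : ℕ} {f : Fin r → A} {c : A} {C : Type*}
    [CommRing C] {β β' : Dil f c →+* C}
    (h1 : ∀ a, β (algebraMap A _ a) = β' (algebraMap A _ a))
    (h2 : ∀ i, β (Dil.X f c i) = β' (Dil.X f c i)) : β = β' :=
  Ideal.Quotient.ringHom_ext (MvPolynomial.ringHom_ext h1 h2)

/-- The image is bounded because the monomials in the power-bounded `g i` are uniformly bounded and
the norm is ultrametric. -/
theorem Dil.exists_lift {A : Type u} [CommRing A] {r : ℕ} {f : Fin r → A} {c : A} {C : Type*}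
    [NormedCommRing C] [IsUltrametricDist C] (φ : A →+* C) (g : Fin r → C)
    (hg : ∀ i, φ c * g i = φ (f i)) (hφ : ∃ M : ℝ, ∀ a, ‖φ a‖ ≤ M)
    (hb : ∀ i, ∃ K : ℝ, ∀ n : ℕ, ‖g i ^ n‖ ≤ K) :
    ∃ β : Dil f c →+* C, (∀ a, β (algebraMap A _ a) = φ a) ∧ (∀ i, β (Dil.X f c i) = g i) ∧
      ∃ M : ℝ, ∀ a, ‖β a‖ ≤ M := by
  let e := MvPolynomial.eval₂Hom φ g
  have he : ∀ a ∈ Ideal.span (Set.range fun i =>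
      MvPolynomial.C c * MvPolynomial.X i - MvPolynomial.C (f i)), e a = 0 := by
    intro a ha
    rw [← RingHom.mem_ker]
    refine (Ideal.span_le (I := RingHom.ker e)).2 ?_ ha
    rintro _ ⟨i, rfl⟩
    simp [e, RingHom.mem_ker, hg]
  refine ⟨Ideal.Quotient.lift _ e he, fun a => ?_, fun i => ?_, ?_⟩
  · exact (Ideal.Quotient.lift_mk _ _ _).trans (MvPolynomial.eval₂Hom_C φ g a)
  · exact (Ideal.Quotient.lift_mk _ _ _).trans (MvPolynomial.eval₂Hom_X' φ g i)
  · obtain ⟨M, hM⟩ := hφ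
    choose K hK using hb
    have hM0 : 0 ≤ M := (norm_nonneg _).trans (hM 0)
    have hK0 : 0 ≤ ∏ i, K i := Finset.prod_nonneg fun i _ => (norm_nonneg _).trans (hK i 0)
    refine ⟨M * ∏ i, K i, fun a => ?_⟩
    obtain ⟨q, rfl⟩ := Ideal.Quotient.mk_surjective a
    rw [Ideal.Quotient.lift_mk]
    change ‖MvPolynomial.eval₂ φ g q‖ ≤ _
    rw [MvPolynomial.eval₂_eq']
    refine IsUltrametricDist.norm_sum_le_of_forall_le_of_nonneg (mul_nonneg hM0 hK0) fun t _ => ?_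
    exact (norm_mul_prod_pow_le g K hK _ _ _).trans (mul_le_mul_of_nonneg_right (hM _) hK0)

/-- The properties of the completion needed to extend maps by continuity: the topology of `P` is
induced from `B`, and the image of `P` is dense. -/
theorem exists_completion (P : Type u) [CommRing P] [Algebra (IntRing L) P] (hP : IsNoetherianRing P)
    (K : Ideal P) (hK : (maximalIdeal (IntRing L)).map (algebraMap (IntRing L) P) ≤ K)
    (hft : Algebra.FiniteType (IntRing L) (P ⧸ K)) :
    ∃ (B : FormalAlg L) (j : P →+* B), IsAdic (K.map j) ∧
      (∀ k, (K.map j ^ k).comap j = K ^ k) ∧ (∀ b k, ∃ a, j a - b ∈ K.map j ^ k) ∧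
      ∀ s, j (algebraMap (IntRing L) P s) = algebraMap (IntRing L) B s := by
  have hfg : K.FG := hP.noetherian K
  let j : P →+* AdicCompletion K P := algebraMap P (AdicCompletion K P)
  have hker (k : ℕ) (b : AdicCompletion K P) :
      b ∈ K.map j ^ k ↔ AdicCompletion.evalₐ K k b = 0 := by
    rw [← RingHom.mem_ker, ← pow_map_eq_ker_evalₐ hfg k]
  have hj (k : ℕ) (a : P) : AdicCompletion.evalₐ K k (j a) = Ideal.Quotient.mk (K ^ k) a :=
    AdicCompletion.evalₐ_of K k a
  have hd (b : AdicCompletion K P) (k : ℕ) : ∃ a, j a - b ∈ K.map j ^ k := by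
    obtain ⟨a, ha⟩ := Ideal.Quotient.mk_surjective (AdicCompletion.evalₐ K k b)
    refine ⟨a, (hker k _).2 ?_⟩
    rw [map_sub, hj, ha, sub_self]
  have hcomap (k : ℕ) : (K.map j ^ k).comap j = K ^ k := by
    ext a
    rw [Ideal.mem_comap, hker, hj, Ideal.Quotient.eq_zero_iff_mem]
  exact ⟨completedAlg P hP K hK hft, j, rfl, hcomap, hd, fun s => rfl⟩

/-- The completed dilatation of an adic algebra `A`: the functions `f_i/ϖ^m` are adjoined, as
topologically nilpotent elements if `nil` holds. -/
theorem exists_dilatation {ϖ : IntRing L} (h : IsUnif ϖ) (A : FormalAlg L) {r : ℕ} (f : Fin r → A)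
    (m : ℕ) (nil : Prop) :
    ∃ (B : FormalAlg L) (ι : A →+* B) (ξ : Fin r → B), Continuous ι ∧
      (∀ s, ι (algebraMap (IntRing L) A s) = algebraMap (IntRing L) B s) ∧
      (∀ i, algebraMap (IntRing L) B (ϖ ^ m) * ξ i = ι (f i)) ∧
      (nil → ∃ J : Ideal B, IsAdic J ∧ ∀ i, ξ i ∈ J) ∧
      (∀ (C : Type u) [NormedCommRing C] [NormedAlgebra L C] [IsUltrametricDist C]
        [CompleteSpace C], (∀ β β' : ContHom B C, (∀ a, β.1 (ι a) = β'.1 (ι a)) → β = β') ∧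
        ∀ (φ : ContHom A C) (g : Fin r → C),
          (∀ i, algebraMap L C ((ϖ : L) ^ m) * g i = φ.1 (f i)) →
          (∀ i, ∃ K : ℝ, ∀ n : ℕ, ‖g i ^ n‖ ≤ K) →
          (nil → ∀ i, ∀ ε > 0, ∃ n : ℕ, ‖g i ^ n‖ ≤ ε) →
          ∃ β : ContHom B C, ∀ a, β.1 (ι a) = φ.1 a) := by
  obtain ⟨I, hI, -, hmax, hft⟩ := A.exists_idealOfDefinition
  have := A.noetherian
  let c : A := algebraMap (IntRing L) A (ϖ ^ m)
  let P := Dil f c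
  -- Completing along `I` alone makes the fractions power-bounded at points, as for a closed disc;
  -- including them in `K` makes them topologically nilpotent, as for an open disc.
  let S : Set P := algebraMap A P '' I ∪ {x | nil ∧ x ∈ Set.range (Dil.X f c)}
  let K : Ideal P := Ideal.span S
  have hIK : I.map (algebraMap A P) ≤ K := Ideal.span_mono Set.subset_union_left
  have hP : IsNoetherianRing P := inferInstance
  have hK : (maximalIdeal (IntRing L)).map (algebraMap (IntRing L) P) ≤ K := by
    rw [IsScalarTower.algebraMap_eq (IntRing L) A P, ← Ideal.map_map]
    exact (Ideal.map_mono hmax).trans hIK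
  have hPK : Algebra.FiniteType (IntRing L) (P ⧸ K) := by
    have : Algebra.FiniteType A (P ⧸ K) := inferInstance
    refine finiteType_of_factors (O := IntRing L) (A := A) (Q := P ⧸ K) (I := I) fun a ha => ?_
    rw [RingHom.mem_ker, IsScalarTower.algebraMap_apply A P (P ⧸ K)]
    exact Ideal.Quotient.eq_zero_iff_mem.2 (hIK (Ideal.mem_map_of_mem _ ha))
  have hfg : K.FG := hP.noetherian K
  obtain ⟨B, j, hJ, hcomap, hd, hcomm'⟩ := exists_completion P hP K hK hPK
  let J : Ideal B := K.map j
  have hcomm (s : IntRing L) : j (algebraMap A P (algebraMap (IntRing L) A s)) =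
      algebraMap (IntRing L) B s := by
    rw [← IsScalarTower.algebraMap_apply]
    exact hcomm' s
  refine ⟨B, j.comp (algebraMap A P), fun i => j (Dil.X f c i), ?_, hcomm, fun i => ?_, fun hn =>
    ⟨J, hJ, fun i => ?_⟩, fun C _ _ _ _ => ⟨fun β β' hββ' => ?_, fun φ g hg hb hn => ?_⟩⟩
  · refine continuous_of_le_comap hI hJ _ ?_
    rw [← Ideal.map_map]
    exact Ideal.map_mono hIK
  · rw [← hcomm, ← map_mul]
    exact congrArg j (Dil.mul_X f c i)
  · exact Ideal.mem_map_of_mem j (Ideal.subset_span (Or.inr ⟨hn, i, rfl⟩))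
  · have hu : IsUnit (algebraMap L C ((ϖ : L) ^ m)) :=
      (IsUnit.mk0 _ (pow_ne_zero m h.ne_zero)).map _
    -- Since `ϖ` is invertible in `C`, the values of the fractions are determined by those on `A`;
    -- `ϖ`-torsion in `B`, if any, is harmless.
    have hX (γ : ContHom B C) (i : Fin r) : algebraMap L C ((ϖ : L) ^ m) * γ.1 (j (Dil.X f c i)) =
        γ.1 (j (algebraMap A P (f i))) := by
      have h1 := γ.2.2 (ϖ ^ m)
      rw [← hcomm] at h1
      have h2 : ((ϖ ^ m : IntRing L) : L) = (ϖ : L) ^ m := by simp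
      rw [← h2, ← h1, ← map_mul, ← map_mul, Dil.mul_X f c i]
    have h1 : β.1.comp j = β'.1.comp j := by
      refine Dil.hom_ext hββ' fun i => hu.mul_left_cancel ?_
      exact (hX β i).trans ((hββ' _).trans (hX β' i).symm)
    refine Subtype.ext (RingHom.ext fun b => ?_)
    exact congrFun ((denseRange_of_isAdic hJ j hd).equalizer β.2.1 β'.2.1
      (funext fun a => RingHom.congr_fun h1 a)) b
  · have hφc : φ.1 c = algebraMap L C ((ϖ : L) ^ m) := by
      rw [φ.2.2]
      simp
    obtain ⟨β, hβ1, hβ2, M, hM⟩ := Dil.exists_lift (f := f) (c := c) φ.1 g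
      (fun i => by rw [hφc, hg]) (φ.exists_norm_le h) hb
    obtain ⟨F, hF, hFβ⟩ := exists_extension_of_isAdic hJ j hcomap hd β
      (exists_pow_norm_lt β hM hfg (by
        rintro s (⟨a, ha, rfl⟩ | ⟨hnil, i, rfl⟩) ε hε
        · rw [hβ1]
          exact φ.exists_norm_pow_le hI ha hε
        · rw [hβ2]
          exact hn hnil i ε hε))
    refine ⟨⟨F, hF, fun s => ?_⟩, fun a => (hFβ _).trans (hβ1 a)⟩
    rw [← hcomm, hFβ, hβ1, φ.2.2]

end Dilatation

/-! ### Formal models of residue neighbourhoods -/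

section Neighbourhoods

variable {L : Type u} [NormedField L] [IsUltrametricDist L] {ϖ : IntRing L}

/-- Restriction of points along a continuous homomorphism of adic algebras. -/
def ContHom.comp {A B : FormalAlg L} {C : Type u} [CommRing C] [TopologicalSpace C] [Algebra L C]
    (β : ContHom B C) (ι : A →+* B) (hι : Continuous ι)
    (hι' : ∀ s, ι (algebraMap (IntRing L) A s) = algebraMap (IntRing L) B s) : ContHom A C :=
  ⟨β.1.comp ι, β.2.1.comp hι, fun s => by rw [RingHom.comp_apply, hι', β.2.2]⟩

/-- Composition of a point with a homomorphism of topological algebras. -/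
def ContHom.push {B : FormalAlg L} {C D : Type u} [CommRing C] [TopologicalSpace C] [Algebra L C]
    [CommRing D] [TopologicalSpace D] [Algebra L D] (ψ : C →A[L] D) (β : ContHom B C) :
    ContHom B D :=
  ⟨((ψ : C →ₐ[L] D) : C →+* D).comp β.1, ψ.cont.comp β.2.1, fun s => by
    rw [RingHom.comp_apply, β.2.2]
    exact ψ.commutes' (s : L)⟩

theorem AffineFormalModel.point_hom {X : RigidFunctor L} (𝒳 : AffineFormalModel X)
    {C : AffinoidAlg L} (φ : ContHom 𝒳.A C) :
    𝒳.point (𝒳.iso.hom.app C φ) = φ := by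
  have h := congrArg (fun t => t.app C) 𝒳.iso.hom_inv_id
  exact congrArg (fun t : (genericFiber 𝒳.A).obj C ⟶ (genericFiber 𝒳.A).obj C => t φ) h

theorem AffineFormalModel.hom_point {X : RigidFunctor L} (𝒳 : AffineFormalModel X)
    {C : AffinoidAlg L} (y : X.obj C) :
    𝒳.iso.hom.app C (𝒳.point y) = y := by
  have h := congrArg (fun t => t.app C) 𝒳.iso.inv_hom_id
  exact congrArg (fun t : X.obj C ⟶ X.obj C => t y) h

/-- The coefficients of a combination of generators have absolute value at most `1`, so a strict
ultrametric bound extends to the ideal. -/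
theorem ContHom.norm_lt_of_mem_span (h : IsUnif ϖ) {A : FormalAlg L} {E : Type u} [NormedField E]
    [IsUltrametricDist E] [NormedAlgebra L E] (φ : ContHom A E) {S : Set A} {c : ℝ} (hc : 0 < c)
    (hS : ∀ s ∈ S, ‖φ.1 s‖ < c) {a : A} (ha : a ∈ Ideal.span S) : ‖φ.1 a‖ < c := by
  let T : Ideal A :=
    { carrier := {a | ‖φ.1 a‖ < c}
      add_mem' := fun {a a'} ha ha' => by
        rw [Set.mem_ofPred_eq, map_add]
        exact (IsUltrametricDist.norm_add_le_max _ _).trans_lt (max_lt ha ha')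
      zero_mem' := by simpa using hc
      smul_mem' := fun b a ha => by
        rw [smul_eq_mul, Set.mem_ofPred_eq, map_mul, norm_mul]
        exact (mul_le_of_le_one_left (norm_nonneg _) (φ.norm_le_one h b)).trans_lt ha }
  exact (Ideal.span_le (I := T)).2 hS ha

theorem ContHom.norm_le_of_mem_span (h : IsUnif ϖ) {A : FormalAlg L} {E : Type u} [NormedField E]
    [IsUltrametricDist E] [NormedAlgebra L E] (φ : ContHom A E) {S : Set A} {c : ℝ} (hc : 0 ≤ c)
    (hS : ∀ s ∈ S, ‖φ.1 s‖ ≤ c) {a : A} (ha : a ∈ Ideal.span S) : ‖φ.1 a‖ ≤ c := by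
  refine le_of_forall_gt fun d hd => ?_
  exact φ.norm_lt_of_mem_span h (hc.trans_lt hd) (fun s hs => (hS s hs).trans_lt hd) ha

/-- A subspace of `X` on which a natural family of points of another formal scheme is universal
has a formal model. -/
theorem exists_model_of_bijective {X : RigidFunctor L} (𝒳 : AffineFormalModel X) (U : Subfunctor X)
    (B : FormalAlg L) (ι : 𝒳.A →+* B) (hι : Continuous ι)
    (hι' : ∀ s, ι (algebraMap (IntRing L) 𝒳.A s) = algebraMap (IntRing L) B s)
    (hmem : ∀ (C : AffinoidAlg L) (β : ContHom B C), 𝒳.iso.hom.app C (β.comp ι hι hι') ∈ U.obj C)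
    (hinj : ∀ (C : AffinoidAlg L) (β β' : ContHom B C), (∀ a, β.1 (ι a) = β'.1 (ι a)) → β = β')
    (hsurj : ∀ (C : AffinoidAlg L), ∀ y ∈ U.obj C, ∃ β : ContHom B C,
      ∀ a, β.1 (ι a) = (𝒳.point y).1 a) :
    ∃ i : genericFiber B ≅ U.toFunctor,
      (AffineFormalModel.toGlobal ⟨B, i⟩).comp ι =
        (GlobalFun.pullback U.ι).comp 𝒳.toGlobal := by
  let τ : genericFiber B ⟶ U.toFunctor :=
    { app := fun C => ↾fun β => ⟨𝒳.iso.hom.app C (ContHom.comp β ι hι hι'), hmem C β⟩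
      naturality := fun C D ψ => by
        ext β
        apply Subtype.ext
        exact NatTrans.naturality_apply 𝒳.iso.hom ψ (ContHom.comp β ι hι hι') }
  have hτ (C : AffinoidAlg L) : Function.Bijective (τ.app C) := by
    constructor
    · intro β β' hββ'
      have h1 : 𝒳.iso.hom.app C (ContHom.comp β ι hι hι') =
        𝒳.iso.hom.app C (ContHom.comp β' ι hι hι') := congrArg Subtype.val hββ'
      have h2 : ContHom.comp β ι hι hι' = ContHom.comp β' ι hι hι' := by
        rw [← 𝒳.point_hom (ContHom.comp β ι hι hι'), h1, 𝒳.point_hom]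
      exact hinj C β β' fun a => congrArg (fun t : ContHom 𝒳.A C => t.1 a) h2
    · rintro ⟨y, hy⟩
      obtain ⟨β, hβ⟩ := hsurj C y hy
      refine ⟨β, Subtype.ext ?_⟩
      have h2 : ContHom.comp β ι hι hι' = 𝒳.point y := Subtype.ext (RingHom.ext hβ)
      change 𝒳.iso.hom.app C (ContHom.comp β ι hι hι') = y
      rw [h2, 𝒳.hom_point]
  have : IsIso τ := by
    rw [NatTrans.isIso_iff_isIso_app]
    exact fun C => (isIso_iff_bijective _).2 (hτ C)
  refine ⟨asIso τ, RingHom.ext fun a => Subtype.ext (funext fun C => funext fun y => ?_)⟩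
  obtain ⟨β, rfl⟩ := (hτ C).2 y
  have h1 := AffineFormalModel.point_hom (⟨B, asIso τ⟩ : AffineFormalModel U.toFunctor) β
  have h2 := 𝒳.point_hom (ContHom.comp β ι hι hι')
  change (AffineFormalModel.point (⟨B, asIso τ⟩ : AffineFormalModel U.toFunctor)
    (τ.app C β)).1 (ι a) = (𝒳.point (𝒳.iso.hom.app C (ContHom.comp β ι hι hι'))).1 a
  rw [h2]
  exact congrArg (fun t : ContHom B C => t.1 (ι a)) h1

/-- Residue neighbourhoods have formal models, which are dilatations. -/
theorem exists_model_normLocus [CompleteSpace L] (h : IsUnif ϖ) {X : RigidFunctor L}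
    (𝒳 : AffineFormalModel X) {r : ℕ} (f : Fin r → 𝒳.A) (m : ℕ) (nil : Prop) (P : ℝ → Prop)
    (hP : (nil ∧ P = fun s => s < ‖(ϖ : L)‖ ^ m) ∨ (¬ nil ∧ P = fun s => s ≤ ‖(ϖ : L)‖ ^ m)) :
    ∃ (𝒴 : AffineFormalModel (normLocus 𝒳 (Ideal.span (Set.range f)) P).toFunctor)
      (ι : 𝒳.A →+* 𝒴.A) (ξ : Fin r → 𝒴.A), Continuous ι ∧
      (∀ s, ι (algebraMap (IntRing L) 𝒳.A s) = algebraMap (IntRing L) 𝒴.A s) ∧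
      (∀ i, algebraMap (IntRing L) 𝒴.A (ϖ ^ m) * ξ i = ι (f i)) ∧
      (nil → ∃ J : Ideal 𝒴.A, IsAdic J ∧ ∀ i, ξ i ∈ J) ∧
      𝒴.toGlobal.comp ι = (GlobalFun.pullback
        (normLocus 𝒳 (Ideal.span (Set.range f)) P).ι).comp 𝒳.toGlobal := by
  obtain ⟨B, ι, ξ, hι, hι', hξ, hJ, huniv⟩ := exists_dilatation h 𝒳.A f m nil
  have hpos : 0 < ‖(ϖ : L)‖ ^ m := pow_pos h.norm_pos m
  have hval : ((ϖ ^ m : IntRing L) : L) = (ϖ : L) ^ m := by simp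
  refine Exists.elim (exists_model_of_bijective 𝒳 (normLocus 𝒳 (Ideal.span (Set.range f)) P) B ι hι
    hι' (fun C β E _ _ _ _ ψ a ha => ?_) (fun C => (huniv C).1) (fun C y hy => ?_))
    fun i hi => ⟨⟨B, i⟩, ι, ξ, hι, hι', hξ, hJ, hi⟩
  · change P ‖ψ ((𝒳.point (𝒳.iso.hom.app C (β.comp ι hι hι'))).1 a)‖
    rw [𝒳.point_hom]
    let γ : ContHom B E := β.push ψ
    change P ‖(γ.comp ι hι hι').1 a‖
    have hγ (i : Fin r) : ‖(γ.comp ι hι hι').1 (f i)‖ = ‖(ϖ : L)‖ ^ m * ‖γ.1 (ξ i)‖ := by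
      change ‖γ.1 (ι (f i))‖ = _
      rw [← hξ, map_mul, γ.2.2, norm_algebraMap_mul, hval, norm_pow]
    rcases hP with ⟨hnil, rfl⟩ | ⟨hnil, rfl⟩
    · refine (γ.comp ι hι hι').norm_lt_of_mem_span h hpos ?_ ha
      rintro _ ⟨i, rfl⟩
      obtain ⟨J, hJ, hξJ⟩ := hJ hnil
      rw [hγ]
      exact mul_lt_of_lt_one_right hpos (γ.norm_lt_one hJ (hξJ i))
    · refine (γ.comp ι hι hι').norm_le_of_mem_span h hpos.le ?_ ha
      rintro _ ⟨i, rfl⟩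
      rw [hγ]
      exact mul_le_of_le_one_right hpos.le (γ.norm_le_one h _)
  · let φ := 𝒳.point y
    let g : Fin r → C := fun i => algebraMap L C ((ϖ : L) ^ m)⁻¹ * φ.1 (f i)
    have hg (i : Fin r) (E : Type u) [NormedField E] [IsUltrametricDist E] [NormedAlgebra L E]
        [FiniteDimensional L E] (ψ : C →A[L] E) :
        ‖ψ (g i)‖ = ‖ψ (φ.1 (f i))‖ / ‖(ϖ : L)‖ ^ m := by
      rw [map_mul, AlgHomClass.commutes, norm_algebraMap_mul, norm_inv, norm_pow, div_eq_inv_mul]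
    have hy' (i : Fin r) (E : Type u) [NormedField E] [IsUltrametricDist E] [NormedAlgebra L E]
        [FiniteDimensional L E] (ψ : C →A[L] E) : P ‖ψ (φ.1 (f i))‖ :=
      hy E ψ (f i) (Ideal.subset_span ⟨i, rfl⟩)
    -- The bounds at all points of `Sp C` become a statement about the powers of `g i` in `C`, as
    -- the universal property of the dilatation requires.
    have hb (i : Fin r) := AffinoidAlg.exists_bound_pow h C (g i) fun E _ _ _ _ ψ => by
      rw [hg, div_le_one hpos]
      have := hy' i E ψ
      rcases hP with ⟨hnil, rfl⟩ | ⟨hnil, rfl⟩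
      · exact le_of_lt this
      · exact this
    refine (huniv C).2 φ g (fun i => ?_) (fun i => (hb i).1) fun hnil i => (hb i).2 ?_
    · rw [← mul_assoc, ← map_mul, mul_inv_cancel₀ (pow_ne_zero m h.ne_zero), map_one, one_mul]
    · intro E _ _ _ _ ψ
      rw [hg, div_lt_one hpos]
      have := hy' i E ψ
      rcases hP with ⟨_, rfl⟩ | ⟨hnil', rfl⟩
      · exact this
      · exact absurd hnil hnil'

end Neighbourhoods

/-! ### Extension of scalars -/

section Extension

universe u₁ u₂ u₃ w₁ w₂ w₃

variable {R : Type u₁} {S : Type u₂} {T : Type u₃} [CommRing R] [CommRing S] [CommRing T]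
  {G : Type w} [Group G]

theorem RepIso.symm {M : Rep.{w₁} R G} {N : Rep.{w₂} R G} (h : RepIso M N) : RepIso N M :=
  h.map fun e => e.symm

theorem RepIso.trans {M : Rep.{w₁} R G} {N : Rep.{w₂} R G} {Q : Rep.{w₃} R G} (h : RepIso M N)
    (h' : RepIso N Q) : RepIso M Q :=
  h.elim fun e => h'.elim fun e' => ⟨e.trans e'⟩

theorem repIso_of {V : Type w₁} {W : Type w₂} [AddCommGroup V] [AddCommGroup W] [Module R V]
    [Module R W] (ρ : Representation R G V) (σ : Representation R G W) (e : V ≃ₗ[R] W)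
    (he : ∀ g v, e (ρ g v) = σ g (e v)) : RepIso (Rep.of ρ) (Rep.of σ) :=
  ⟨.mk e fun g => LinearMap.ext (he g)⟩

theorem RepIso.extScalars (f : R →+* S) {M : Rep.{w₁} R G} {N : Rep.{w₂} R G} (h : RepIso M N) :
    RepIso (extScalars f M) (extScalars f N) := by
  obtain ⟨e⟩ := h
  let _ := f.toAlgebra
  refine repIso_of _ _ (LinearEquiv.baseChange R S M.V N.V e.toLinearEquiv) fun g v => ?_
  change LinearEquiv.baseChange R S M.V N.V e.toLinearEquiv ((M.ρ g).baseChange S v) =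
    (N.ρ g).baseChange S (LinearEquiv.baseChange R S M.V N.V e.toLinearEquiv v)
  induction v with
  | zero => simp
  | add y z hy hz => simp only [map_add, hy, hz]
  | tmul s m =>
    change s ⊗ₜ[R] e.toLinearEquiv (M.ρ g m) = s ⊗ₜ[R] N.ρ g (e.toLinearEquiv m)
    congr 1
    exact LinearMap.congr_fun (e.isIntertwining' g) m

theorem repIso_extScalars_comp (f : S →+* T) (g : R →+* S) (M : Rep.{w₁} R G) :
    RepIso (extScalars f (extScalars g M)) (extScalars (f.comp g) M) := by
  let _ := f.toAlgebra
  let _ := g.toAlgebra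
  let _ := (f.comp g).toAlgebra
  have : IsScalarTower R S T := .of_algebraMap_eq fun _ => rfl
  let e := TensorProduct.AlgebraTensorModule.cancelBaseChange R S T T M.V
  have he (x : G) (v : T ⊗[S] (S ⊗[R] M.V)) :
      e (((M.ρ x).baseChange S).baseChange T v) = (M.ρ x).baseChange T (e v) := by
    induction v with
    | zero => simp
    | add y z hy hz => simp only [map_add, hy, hz]
    | tmul t y =>
      induction y with
      | zero => simp
      | add y z hy hz => simp only [TensorProduct.tmul_add, map_add, hy, hz]
      | tmul s m => rfl
  exact repIso_of _ _ e he

theorem repIso_extScalars_extScalars {f : S →+* T} {g : R →+* S} {S' : Type*} [CommRing S']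
    {f' : S' →+* T} {g' : R →+* S'} (h : f.comp g = f'.comp g') (M : Rep.{w₁} R G) :
    RepIso (extScalars f (extScalars g M)) (extScalars f' (extScalars g' M)) :=
  (repIso_extScalars_comp f g M).trans (h ▸ (repIso_extScalars_comp f' g' M).symm)

theorem free_extScalars (f : R →+* S) {M : Rep.{w₁} R G} (h : Module.Free R M) :
    Module.Free S (extScalars f M) := by
  let _ := f.toAlgebra
  have : Module.Free R M.V := h
  exact inferInstanceAs (Module.Free S (S ⊗[R] M.V))

theorem finite_extScalars (f : R →+* S) {M : Rep.{w₁} R G} (h : Module.Finite R M) :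
    Module.Finite S (extScalars f M) := by
  let _ := f.toAlgebra
  have : Module.Finite R M.V := h
  exact inferInstanceAs (Module.Finite S (S ⊗[R] M.V))

/-- In a basis coming from `M`, the new matrix coefficients are finite `S`-linear combinations of
images under `f` of the old ones. -/
theorem IsFreeContRep.extScalars [TopologicalSpace R] [TopologicalSpace S] [IsTopologicalRing S]
    [TopologicalSpace G] {M : Rep.{w₁} R G} (h : IsFreeContRep M) (f : R →+* S)
    (hf : Continuous f) : IsFreeContRep (extScalars f M) := by
  refine ⟨free_extScalars f h.free, finite_extScalars f h.finite, ?_⟩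
  let _ := f.toAlgebra
  have := h.free
  have := h.finite
  let b := Module.Free.chooseBasis R M.V
  intro l m
  let l' : S ⊗[R] M.V →ₗ[S] S := l
  let m' : S ⊗[R] M.V := m
  change Continuous fun g => l' ((M.ρ g).baseChange S m')
  generalize m' = m''
  induction m'' with
  | zero => simpa using continuous_const
  | add y z hy hz =>
    simp only [map_add]
    exact hy.add hz
  | tmul s m =>
    have key (g : G) : l' ((M.ρ g).baseChange S (s ⊗ₜ m)) =
        s * ∑ i, f (b.coord i (M.ρ g m)) * l' (1 ⊗ₜ b i) := by
      have h1 : s ⊗ₜ[R] M.ρ g m = s • ∑ i, (b.coord i (M.ρ g m)) • ((1 : S) ⊗ₜ[R] b i) := by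
        conv_lhs => rw [← b.sum_repr (M.ρ g m)]
        rw [TensorProduct.tmul_sum, Finset.smul_sum]
        refine Finset.sum_congr rfl fun i _ => ?_
        rw [smul_comm, TensorProduct.smul_tmul', smul_eq_mul, mul_one, TensorProduct.tmul_smul]
        rfl
      rw [LinearMap.baseChange_tmul, h1, map_smul, map_sum, smul_eq_mul]
      congr 1
      refine Finset.sum_congr rfl fun i _ => ?_
      rw [← algebraMap_smul S, map_smul, smul_eq_mul]
      rfl
    simp only [key]
    exact continuous_const.mul (continuous_finsetSum _ fun i _ =>
      (hf.comp (h.continuous _ _)).mul continuous_const)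

end Extension

/-! ### Restriction of lattices -/

section Lattices

variable {L : Type u} [NormedField L] [IsUltrametricDist L] {G : Type v} [Group G]
  [TopologicalSpace G]

/-- The restriction of a lattice to a subspace with a compatible formal model. -/
theorem IsLattice.restrict {X : RigidFunctor L} {𝒳 : AffineFormalModel X} {𝒱 : Rep.{u} 𝒳.A G}
    {V : Rep.{w} (GlobalFun X) G} (h : IsLattice 𝒳 𝒱 V) {U : Subfunctor X}
    (𝒴 : AffineFormalModel U.toFunctor) (ι : 𝒳.A →+* 𝒴.A) (hι : Continuous ι)
    (hg : 𝒴.toGlobal.comp ι = (GlobalFun.pullback U.ι).comp 𝒳.toGlobal) :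
    IsLattice 𝒴 (extScalars ι 𝒱) (restrict V U) := by
  obtain ⟨J, hJ, -⟩ := 𝒴.A.exists_idealOfDefinition
  have := hJ.isTopologicalRing
  exact ⟨h.isGRep.extScalars ι hι, (repIso_extScalars_extScalars hg 𝒱).trans
    (h.genericFiber_iso.extScalars _)⟩

end Lattices

/-! ### Constancy on residue neighbourhoods -/

theorem maximalIdeal_pow_le_comap (L : Type u) (E : Type v) [NormedField L]
    [IsUltrametricDist L] [NormedField E] [IsUltrametricDist E] [NormedAlgebra L E] (m : ℕ) : maximalIdeal (IntRing L) ^ m ≤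
      (maximalIdeal (IntRing E) ^ (m * ramIdx L E)).comap (intRingMap L E) := by
  let _ := (intRingMap L E).toAlgebra
  rw [← Ideal.map_le_iff_le_comap, Ideal.map_pow, mul_comm, pow_mul]
  exact Ideal.pow_right_mono (Ideal.le_pow_ramificationIdx'
    (p := maximalIdeal (IntRing L)) (P := maximalIdeal (IntRing E))) m

section Constancy

variable {L : Type u} [NormedField L] [IsUltrametricDist L] [CompleteSpace L] {ϖ : IntRing L}
  {G : Type v} [Group G]

/-- The values at an `L`-rational point are integral. -/
theorem exists_eval (h : IsUnif ϖ) {X : RigidFunctor L} (𝒳 : AffineFormalModel X)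
    (x : X.obj (AffinoidAlg.self L)) : ∃ e : 𝒳.A →+* IntRing L,
      ∀ a, a - algebraMap (IntRing L) 𝒳.A (e a) ∈ vanishingIdeal 𝒳 x := by
  let φ : ContHom 𝒳.A L := 𝒳.point x
  let e : 𝒳.A →+* IntRing L :=
    φ.1.codRestrict (IntRing L) fun a => mem_intRing.2 (φ.norm_le_one h a)
  refine ⟨e, fun a => ?_⟩
  change φ.1 (a - algebraMap (IntRing L) 𝒳.A (e a)) = 0
  rw [map_sub, φ.2.2]
  exact sub_self _

/-- Every point of `B` over `𝒪_E` restricts on `A`, modulo the given power of `𝔪_E`, to evaluation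
at `x`; so every reduction is that of the fibre at `x`. -/
theorem isPointwiseConst_of_dilatation (h : IsUnif ϖ) {X : RigidFunctor L}
    (𝒳 : AffineFormalModel X) (x : X.obj (AffinoidAlg.self L)) {r : ℕ} {f : Fin r → 𝒳.A}
    (hf : vanishingIdeal 𝒳 x = Ideal.span (Set.range f)) {n : ℕ} {B : FormalAlg L} (ι : 𝒳.A →+* B)
    (hι : ∀ s, ι (algebraMap (IntRing L) 𝒳.A s) = algebraMap (IntRing L) B s) (ξ : Fin r → B)
    (hξ : ∀ i, algebraMap (IntRing L) B (ϖ ^ (n - 1)) * ξ i = ι (f i)) {J : Ideal B}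
    (hJ : IsAdic J) (hξJ : ∀ i, ξ i ∈ J) (𝒱 : Rep.{u} 𝒳.A G) :
    IsPointwiseConstLattice (extScalars ι 𝒱) n := by
  obtain ⟨e, he⟩ := exists_eval h 𝒳 x
  intro E _ _ _ _ y y'
  let q := Ideal.Quotient.mk (maximalIdeal (IntRing E) ^ gam L E n)
  have key (z : RigPoint B E) : (q.comp z.hom).comp ι = (q.comp (intRingMap L E)).comp e := by
    ext a
    refine Ideal.Quotient.eq.2 ?_
    rw [← z.commutes, ← hι, ← map_sub, ← map_sub]
    let ψ : ContHom B E := ⟨(IntRing E).subtype.comp z.hom,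
      continuous_subtype_val.comp z.continuous, fun s => by
        rw [RingHom.comp_apply, z.commutes]
        rfl⟩
    have hle : Ideal.span (Set.range f) ≤
        (maximalIdeal (IntRing E) ^ gam L E n).comap (z.hom.comp ι) := by
      refine Ideal.span_le.2 ?_
      rintro _ ⟨i, rfl⟩
      change z.hom (ι (f i)) ∈ maximalIdeal (IntRing E) ^ gam L E n
      -- The exponent splits: `(n-1) e_{E/L}` comes from `ϖ^{n-1}`, and the extra `1` from the
      -- topological nilpotence of `ξ i`.
      rw [← hξ, map_mul, z.commutes, gam, pow_succ]
      refine Ideal.mul_mem_mul (maximalIdeal_pow_le_comap L E (n - 1) (Ideal.pow_mem_pow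
        (mem_maximalIdeal_intRing.2 h.norm_lt_one) _)) (mem_maximalIdeal_intRing.2 ?_)
      exact ψ.norm_lt_one hJ (hξJ i)
    exact hle (hf ▸ he a)
  refine (repIso_extScalars_comp _ _ _).trans (RepIso.trans ?_ (repIso_extScalars_comp _ _ _).symm)
  exact repIso_extScalars_extScalars ((key y).trans (key y').symm) 𝒱

/-- Since `ι(I_x) ⊆ ϖ^n B`, `W` can be taken to be the fibre at `x` modulo `ϖ^n`. -/
theorem isConst_of_dilatation (h : IsUnif ϖ) {X : RigidFunctor L}
    (𝒳 : AffineFormalModel X) (x : X.obj (AffinoidAlg.self L)) {r : ℕ} {f : Fin r → 𝒳.A}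
    (hf : vanishingIdeal 𝒳 x = Ideal.span (Set.range f)) {n : ℕ} {B : FormalAlg L} (ι : 𝒳.A →+* B)
    (hι : ∀ s, ι (algebraMap (IntRing L) 𝒳.A s) = algebraMap (IntRing L) B s) (ξ : Fin r → B)
    (hξ : ∀ i, algebraMap (IntRing L) B (ϖ ^ n) * ξ i = ι (f i)) [TopologicalSpace G]
    (𝒱 : Rep.{u} 𝒳.A G) (h𝒱 : IsFreeContRep 𝒱) : IsConstLattice (extScalars ι 𝒱) n := by
  obtain ⟨e, he⟩ := exists_eval h 𝒳 x
  let J : Ideal (IntRing L) := maximalIdeal (IntRing L) ^ n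
  let JB : Ideal B := J.map (algebraMap (IntRing L) B)
  refine ⟨extScalars ((Ideal.Quotient.mk J).comp e) 𝒱, free_extScalars _ h𝒱.free,
    finite_extScalars _ h𝒱.finite, repIso_extScalars_extScalars (RingHom.ext fun a => ?_) 𝒱⟩
  change Ideal.Quotient.mk JB (ι a) = Ideal.Quotient.mk JB (algebraMap (IntRing L) B (e a))
  rw [Ideal.Quotient.eq, ← hι, ← map_sub]
  have hle : Ideal.span (Set.range f) ≤ JB.comap ι := by
    refine Ideal.span_le.2 ?_
    rintro _ ⟨i, rfl⟩
    change ι (f i) ∈ JB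
    rw [← hξ]
    exact JB.mul_mem_right _ (Ideal.mem_map_of_mem _ (Ideal.pow_mem_pow
      (mem_maximalIdeal_intRing.2 h.norm_lt_one) _))
  exact hle (hf ▸ he a)

end Constancy

end RigidLattice

end

theorem mainTheorem2 (p : ℕ) [Fact p.Prime]
    (L : Type u) [NormedField L] [IsUltrametricDist L] [CompleteSpace L]
    [NormedAlgebra ℚ_[p] L] [FiniteDimensional ℚ_[p] L]
    (G : Type v) [Group G] [TopologicalSpace G] [IsTopologicalGroup G] [CompactSpace G]
    (X : RigidLattice.RigidFunctor L)
    (V : Rep.{w} (RigidLattice.GlobalFun X) G) (hV : RigidLattice.IsGRep V)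
    (𝒳 : RigidLattice.AffineFormalModel X)
    (h𝒳 : ∃ 𝒱 : Rep.{u} 𝒳.A G, RigidLattice.IsLattice 𝒳 𝒱 V)
    (x : X.obj (RigidLattice.AffinoidAlg.self L)) (n : ℕ) (hn : 1 ≤ n) :
    RigidLattice.IsPointwiseConst
        (RigidLattice.restrict V (RigidLattice.wideOpenNhd p 𝒳 x n)) n ∧
      RigidLattice.IsConst
        (RigidLattice.restrict V (RigidLattice.affinoidNhd p 𝒳 x n)) n := by
  obtain ⟨ϖ, h, hϖ⟩ := RigidLattice.exists_isUnif p L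
  obtain ⟨𝒱, h𝒱⟩ := h𝒳
  have := 𝒳.A.noetherian
  obtain ⟨r, f, hf⟩ := Submodule.fg_iff_exists_fin_generating_family.1
    (IsNoetherian.noetherian (RigidLattice.vanishingIdeal 𝒳 x))
  replace hf : RigidLattice.vanishingIdeal 𝒳 x = Ideal.span (Set.range f) := hf.symm
  constructor
  · have hU : RigidLattice.wideOpenNhd p 𝒳 x n = RigidLattice.normLocus 𝒳
        (Ideal.span (Set.range f)) fun s => s < ‖(ϖ : L)‖ ^ (n - 1) := by
      -- The exponent `1 - n` is `-(n-1)`, with natural subtraction legitimate because `n ≥ 1`.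
      rw [RigidLattice.wideOpenNhd, hf, ← hϖ, Nat.cast_sub hn, Nat.cast_one, neg_sub]
    rw [hU]
    -- The strict inequality calls for topologically nilpotent fractions, hence `True`; for the
    -- affinoid neighbourhood it is `False`.
    obtain ⟨𝒴, ι, ξ, hι, hι', hξ, hJ, hg⟩ := RigidLattice.exists_model_normLocus h 𝒳 f (n - 1) True
      _ (Or.inl ⟨trivial, rfl⟩)
    obtain ⟨J, hJ, hξJ⟩ := hJ trivial
    exact ⟨𝒴, _, h𝒱.restrict 𝒴 ι hι hg,
      RigidLattice.isPointwiseConst_of_dilatation h 𝒳 x hf ι hι' ξ hξ hJ hξJ 𝒱⟩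
  · have hU : RigidLattice.affinoidNhd p 𝒳 x n = RigidLattice.normLocus 𝒳
        (Ideal.span (Set.range f)) fun s => s ≤ ‖(ϖ : L)‖ ^ n := by
      rw [RigidLattice.affinoidNhd, hf, ← hϖ]
    rw [hU]
    obtain ⟨𝒴, ι, ξ, hι, hι', hξ, -, hg⟩ := RigidLattice.exists_model_normLocus h 𝒳 f n False
      _ (Or.inr ⟨not_false, rfl⟩)
    exact ⟨𝒴, _, h𝒱.restrict 𝒴 ι hι hg,
      RigidLattice.isConst_of_dilatation h 𝒳 x hf ι hι' ξ hξ 𝒱 h𝒱.isGRep⟩
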